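/- Let $X$ be an infinite set and let $X'=\{x':x\in X\}$ be a disjoint copy of $X$. A Brauer graph is a graph with vertex set $X\cup X'$ in which every vertex has degree at most $1$. Let $\mathcal{PB}_X$ be the partial Brauer monoid: its elements are the Brauer graphs; the product $\alpha\beta$ is obtained by identifying the lower row of $\alpha$ with the upper row of $\beta$ (as a middle row $X''$) and joining two distinct vertices of $X\cup X'$ by an edge exactly when they lie in the same connected component of the resulting graph on $X\cup X''\cup X'$. For $\alpha\in\mathcal{PB}_X$ let $t(\alpha)$, $h(\alpha)$, $h^*(\alpha)$, $s(\alpha)$, $s^*(\alpha)$ denote the number of transversals (edges $\{x,y'\}$), upper hooks (edges $\{x,y\}$), lower hooks (edges $\{x',y'\}$), upper singletons (isolated vertices $x$) and lower singletons (isolated vertices $x'$) of $\alpha$, respectively. Let $\mathcal S_X$ be the group of two-sided units of $\mathcal{PB}_X$, and let $F_X$ be the submonoid of $\mathcal{PB}_X$ generated by all idempotents and all two-sided units. For a semigroup $S$ and $A\subseteq S$, the relative rank of $S$ modulo $A$ is $\operatorname{rank}(S:A)=\min\{|U| : U\subseteq S,\ S=\langle A\cup U\rangle\}$. Let $\rho$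 be the number of cardinals $\mu$ with $\aleph_0\le\mu\le|X|$. (i) We have $\operatorname{rank}(F_X:\mathcal S_X)=2+2\rho$. (ii) If $\rho<\aleph_0$, and if $\Omega\subseteq F_X$ with $|\Omega|=2+2\rho$, then $F_X=\langle\mathcal S_X\cup\Omega\rangle$ if and only if $\Omega=\{\alpha_\mu,\beta_\mu : \mu=1\text{ or }\aleph_0\le\mu\le|X|\}$ for some elements $\alpha_\mu,\beta_\mu\in F_X$ such that for each $\mu$, $$t(\alpha_\mu)=t(\beta_\mu)=|X|,\qquad s(\alpha_\mu)<\mu=h(\alpha_\mu),\qquad h(\beta_\mu)<\mu=s(\beta_\mu),$$ and either - $s^*(\alpha_\mu)<\mu=h^*(\alpha_\mu)$ and $h^*(\beta_\mu)<\mu=s^*(\beta_\mu)$, or - $h^*(\alpha_\mu)<\mu=s^*(\alpha_\mu)$ and $s^*(\beta_\mu)<\mu=h^*(\beta_\mu)$. -/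

import Mathlib

open Cardinal

universe u

/-- A Brauer graph on `X ∪ X'`: every vertex has degree at most one.  The vertex `x` of the
upper row `X` is `Sum.inl x`, and the vertex `x'` of the lower row `X'` is `Sum.inr x`. -/
@[ext]
structure PartialBrauer (X : Type u) where
  graph : SimpleGraph (X ⊕ X)
  eq_of_adj : ∀ v a b, graph.Adj v a → graph.Adj v b → a = b

namespace PartialBrauer

variable {X : Type u}

/-- The product graph of `α` and `β`, on the vertex set `X ∪ X'' ∪ X'`, where `x` is `inl x`,
`x''` is `inr (inl x)` and `x'` is `inr (inr x)`.  The lower row of `α` and the upper row of `β`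
are both identified with the middle row `X''`. -/
def productGraph (α β : PartialBrauer X) : SimpleGraph (X ⊕ X ⊕ X) :=
  α.graph.map (Sum.map id Sum.inl) ⊔ β.graph.map Sum.inr

/-- The inclusion of `X ∪ X'` in `X ∪ X'' ∪ X'`. -/
def outer : X ⊕ X → X ⊕ X ⊕ X := Sum.map id Sum.inr

theorem outer_injective : Function.Injective (outer : X ⊕ X → X ⊕ X ⊕ X) :=
  Sum.map_injective.2 ⟨Function.injective_id, Sum.inr_injective⟩

theorem productGraph_adj (α β : PartialBrauer X) (a b : X ⊕ X ⊕ X) :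
    (productGraph α β).Adj a b ↔
      (∃ u v, α.graph.Adj u v ∧ Sum.map id Sum.inl u = a ∧ Sum.map id Sum.inl v = b) ∨
      (∃ u v, β.graph.Adj u v ∧ Sum.inr u = a ∧ Sum.inr v = b) := by
  have h1 : Function.Injective (Sum.map id Sum.inl : X ⊕ X → X ⊕ X ⊕ X) :=
    Sum.map_injective.2 ⟨Function.injective_id, Sum.inl_injective⟩
  have h2 : Function.Injective (Sum.inr : X ⊕ X → X ⊕ X ⊕ X) := Sum.inr_injective
  have e1 := SimpleGraph.map_adj ⟨_, h1⟩ α.graph a b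
  have e2 := SimpleGraph.map_adj ⟨_, h2⟩ β.graph a b
  exact or_congr e1 e2

/-- Two neighbours of a vertex in the product graph that both differ from a third one agree. -/
theorem productGraph_unique (α β : PartialBrauer X) {a b c d : X ⊕ X ⊕ X}
    (hb : (productGraph α β).Adj a b) (hc : (productGraph α β).Adj a c)
    (hd : (productGraph α β).Adj a d) (hcb : c ≠ b) (hdb : d ≠ b) : c = d := by
  have h1 : Function.Injective (Sum.map id Sum.inl : X ⊕ X → X ⊕ X ⊕ X) :=
    Sum.map_injective.2 ⟨Function.injective_id, Sum.inl_injective⟩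
  have hA : ∀ {p q : X ⊕ X ⊕ X}, (∃ u v, α.graph.Adj u v ∧ Sum.map id Sum.inl u = a ∧
      Sum.map id Sum.inl v = p) → (∃ u v, α.graph.Adj u v ∧ Sum.map id Sum.inl u = a ∧
      Sum.map id Sum.inl v = q) → p = q := by
    rintro p q ⟨u, v, h, hu, rfl⟩ ⟨u', v', h', hu', rfl⟩
    obtain rfl := h1 (hu.trans hu'.symm)
    rw [α.eq_of_adj _ _ _ h h']
  have hB : ∀ {p q : X ⊕ X ⊕ X}, (∃ u v, β.graph.Adj u v ∧ (Sum.inr u : X ⊕ X ⊕ X) = a ∧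
      Sum.inr v = p) → (∃ u v, β.graph.Adj u v ∧ (Sum.inr u : X ⊕ X ⊕ X) = a ∧
      Sum.inr v = q) → p = q := by
    rintro p q ⟨u, v, h, hu, rfl⟩ ⟨u', v', h', hu', rfl⟩
    obtain rfl := Sum.inr_injective (hu.trans hu'.symm)
    rw [β.eq_of_adj _ _ _ h h']
  rw [productGraph_adj] at hb hc hd
  rcases hb with hb | hb <;> rcases hc with hc | hc <;> rcases hd with hd | hd
  · exact hA hc hd
  · exact absurd (hA hc hb) hcb
  · exact absurd (hA hd hb) hdb
  · exact hB hc hd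
  · exact hA hc hd
  · exact absurd (hB hd hb) hdb
  · exact absurd (hB hc hb) hcb
  · exact hB hc hd

/-- A vertex of `X ∪ X'` has at most one neighbour in the product graph. -/
theorem productGraph_outer (α β : PartialBrauer X) (a : X ⊕ X) {b c : X ⊕ X ⊕ X}
    (hb : (productGraph α β).Adj (outer a) b) (hc : (productGraph α β).Adj (outer a) c) :
    b = c := by
  rw [productGraph_adj] at hb hc
  rcases a with x | x
  · rcases hb with ⟨u | u, v, h, hu, rfl⟩ | ⟨u, v, h, hu, rfl⟩ <;>
    rcases hc with ⟨u' | u', v', h', hu', rfl⟩ | ⟨u', v', h', hu', rfl⟩ <;>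
    simp [outer] at hu hu'
    subst hu hu'
    rw [α.eq_of_adj _ _ _ h h']
  · rcases hb with ⟨u | u, v, h, hu, rfl⟩ | ⟨u, v, h, hu, rfl⟩ <;>
    rcases hc with ⟨u' | u', v', h', hu', rfl⟩ | ⟨u', v', h', hu', rfl⟩ <;>
    simp [outer] at hu hu'
    subst hu hu'
    rw [β.eq_of_adj _ _ _ h h']

theorem path_end_unique (α β : PartialBrauer X) (v w : X ⊕ X) {b : X ⊕ X ⊕ X}
    (p : (productGraph α β).Walk b (outer v)) (hp : p.IsPath) (a : X ⊕ X ⊕ X)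
    (hab : (productGraph α β).Adj b a) (hpa : a ∉ p.support)
    (q : (productGraph α β).Walk b (outer w)) (hq : q.IsPath) (hqa : a ∉ q.support) :
    v = w := by
  generalize hv' : outer v = v' at p
  induction p generalizing a with
  | nil =>
    subst hv'
    generalize hw' : outer w = w' at q
    cases q with
    | nil => exact outer_injective hw'.symm
    | cons h q' =>
      obtain rfl := productGraph_outer α β v hab h
      simp at hqa
  | @cons b c _ h p' ih =>
    subst hv'
    generalize hw' : outer w = w' at q
    cases q with
    | nil =>
      subst hw'
      obtain rfl := productGraph_outer α β w hab h
      simp at hpa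
    | @cons _ d _ h' q' =>
      subst hw'
      rw [SimpleGraph.Walk.cons_isPath_iff] at hp hq
      simp only [SimpleGraph.Walk.support_cons, List.mem_cons, not_or] at hpa hqa
      have hc : c ≠ a := fun e => hpa.2 (e ▸ p'.start_mem_support)
      have hd : d ≠ a := fun e => hqa.2 (e ▸ q'.start_mem_support)
      obtain rfl := productGraph_unique α β hab h h' hc hd
      exact ih b h.symm q' hq.1 hq.2 rfl hp.1 hp.2

/-- The product `αβ`: distinct vertices of `X ∪ X'` are joined when they lie in the same connected
component of the product graph. -/
instance : Mul (PartialBrauer X) where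
  mul α β :=
    { graph :=
        { Adj := fun a b => a ≠ b ∧ (productGraph α β).Reachable (outer a) (outer b)
          symm := ⟨fun _ _ h => ⟨h.1.symm, h.2.symm⟩⟩
          loopless := ⟨fun _ h => h.1 rfl⟩ }
      eq_of_adj := by
        rintro u v w ⟨huv, h1⟩ ⟨huw, h2⟩
        obtain ⟨p, hp⟩ := h1.exists_isPath
        obtain ⟨q, hq⟩ := h2.exists_isPath
        generalize hv' : outer v = v' at p
        generalize hw' : outer w = w' at q
        cases p with
        | nil => exact absurd (outer_injective hv'.symm) huv
        | cons h p' =>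
          cases q with
          | nil => exact absurd (outer_injective hw'.symm) huw
          | cons h' q' =>
            subst hv' hw'
            obtain rfl := productGraph_outer α β u h h'
            rw [SimpleGraph.Walk.cons_isPath_iff] at hp hq
            exact path_end_unique α β v w p' hp.1 _ h.symm hp.2 q' hq.1 hq.2 }

theorem mul_adj (α β : PartialBrauer X) (a b : X ⊕ X) :
    (α * β).graph.Adj a b ↔ a ≠ b ∧ (productGraph α β).Reachable (outer a) (outer b) :=
  Iff.rfl

/-- The identity: the Brauer graph with edges `{x, x'}` for `x ∈ X`. -/
instance : One (PartialBrauer X) where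
  one :=
    { graph :=
        { Adj := fun a b => b = a.swap
          symm := ⟨fun a b h => by simp [h]⟩
          loopless := ⟨fun a h => by cases a <;> simp at h⟩ }
      eq_of_adj := fun _ _ _ h h' => Eq.trans h (Eq.symm h') }

theorem one_adj (a b : X ⊕ X) : (1 : PartialBrauer X).graph.Adj a b ↔ b = a.swap :=
  Iff.rfl

theorem eq_or_adj_of_reachable (α : PartialBrauer X) {a b : X ⊕ X}
    (h : α.graph.Reachable a b) : a = b ∨ α.graph.Adj a b := by
  obtain ⟨p⟩ := h
  induction p with
  | nil => exact Or.inl rfl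
  | cons h _ ih =>
    rcases ih with rfl | h'
    · exact Or.inr h
    · exact Or.inl (α.eq_of_adj _ _ _ h.symm h')

/-- If `r` collapses each edge of `G` to a point or to an edge of `H`, it preserves
connectedness. -/
theorem reachable_collapse {V W : Type*} {G : SimpleGraph V} {H : SimpleGraph W} (r : V → W)
    (hr : ∀ a b, G.Adj a b → r a = r b ∨ H.Adj (r a) (r b)) {a b : V} (h : G.Reachable a b) :
    H.Reachable (r a) (r b) := by
  obtain ⟨p⟩ := h
  induction p with
  | nil => exact SimpleGraph.Reachable.rfl
  | cons h _ ih =>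
    rcases hr _ _ h with e | h'
    · rw [e]; exact ih
    · exact h'.reachable.trans ih

theorem one_mul' (α : PartialBrauer X) : 1 * α = α := by
  ext a b
  rw [mul_adj]
  constructor
  · rintro ⟨hne, h⟩
    have := reachable_collapse (H := α.graph) (Sum.elim Sum.inl id) (by
      intro c d hcd
      rw [productGraph_adj] at hcd
      rcases hcd with ⟨u, v, huv, rfl, rfl⟩ | ⟨u, v, huv, rfl, rfl⟩
      · rw [one_adj] at huv
        subst huv
        left; cases u <;> simp
      · right; exact huv) h
    have h2 : ∀ c : X ⊕ X, Sum.elim Sum.inl id (outer c) = c := by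
      intro c; cases c <;> simp [outer]
    rw [h2, h2] at this
    exact (eq_or_adj_of_reachable α this).resolve_left hne
  · intro h
    refine ⟨h.ne, ?_⟩
    have key : ∀ c : X ⊕ X, (productGraph 1 α).Reachable (outer c) (Sum.inr c) := by
      rintro (x | x)
      · refine SimpleGraph.Adj.reachable ((productGraph_adj _ _ _ _).2 (Or.inl ?_))
        exact ⟨Sum.inl x, Sum.inr x, rfl, rfl, rfl⟩
      · exact SimpleGraph.Reachable.rfl
    exact ((key a).trans (SimpleGraph.Adj.reachable ((productGraph_adj _ _ _ _).2
      (Or.inr ⟨a, b, h, rfl, rfl⟩)))).trans (key b).symm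

theorem mul_one' (α : PartialBrauer X) : α * 1 = α := by
  ext a b
  rw [mul_adj]
  constructor
  · rintro ⟨hne, h⟩
    have := reachable_collapse (H := α.graph) (Sum.elim Sum.inl (Sum.elim Sum.inr Sum.inr)) (by
      intro c d hcd
      rw [productGraph_adj] at hcd
      rcases hcd with ⟨u, v, huv, rfl, rfl⟩ | ⟨u, v, huv, rfl, rfl⟩
      · right; cases u <;> cases v <;> exact huv
      · rw [one_adj] at huv
        subst huv
        left; cases u <;> simp) h
    have h2 : ∀ c : X ⊕ X,
        Sum.elim Sum.inl (Sum.elim Sum.inr Sum.inr) (outer c) = c := by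
      intro c; cases c <;> simp [outer]
    rw [h2, h2] at this
    exact (eq_or_adj_of_reachable α this).resolve_left hne
  · intro h
    refine ⟨h.ne, ?_⟩
    have key : ∀ c : X ⊕ X,
        (productGraph α 1).Reachable (outer c) (Sum.map id Sum.inl c) := by
      rintro (x | x)
      · exact SimpleGraph.Reachable.rfl
      · refine SimpleGraph.Adj.reachable ((productGraph_adj _ _ _ _).2 (Or.inr ?_))
        exact ⟨Sum.inr x, Sum.inl x, rfl, rfl, rfl⟩
    exact ((key a).trans (SimpleGraph.Adj.reachable ((productGraph_adj _ _ _ _).2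
      (Or.inl ⟨a, b, h, rfl, rfl⟩)))).trans (key b).symm

/-- The graph on the vertices of `S` that joins vertices connected in `G`. -/
def contract {V : Type*} (G : SimpleGraph V) (S : Set V) : SimpleGraph V where
  Adj a b := a ≠ b ∧ a ∈ S ∧ b ∈ S ∧ G.Reachable a b
  symm := ⟨fun _ _ h => ⟨h.1.symm, h.2.2.1, h.2.1, h.2.2.2.symm⟩⟩
  loopless := ⟨fun _ h => h.1 rfl⟩

theorem reachable_contract {V : Type*} (G H : SimpleGraph V) (S : Set V)
    (hH : ∀ a b, H.Adj a b → a ∈ S ∧ b ∈ S) {u v : V} (hu : u ∈ S) (hv : v ∈ S) :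
    (contract G S ⊔ H).Reachable u v ↔ (G ⊔ H).Reachable u v := by
  constructor
  · rintro ⟨p⟩
    clear hu hv
    induction p with
    | nil => exact SimpleGraph.Reachable.rfl
    | cons h _ ih =>
      rcases h with h | h
      · exact (h.2.2.2.mono le_sup_left).trans ih
      · exact (SimpleGraph.Adj.reachable (Or.inr h)).trans ih
  · rintro ⟨p⟩
    have key : ∃ b ∈ S, G.Reachable u b ∧ (contract G S ⊔ H).Reachable b v := by
      clear hu
      induction p with
      | nil => exact ⟨_, hv, SimpleGraph.Reachable.rfl, SimpleGraph.Reachable.rfl⟩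
      | @cons a c _ h _ ih =>
        obtain ⟨b, hb, h1, h2⟩ := ih hv
        rcases h with h | h
        · exact ⟨b, hb, h.reachable.trans h1, h2⟩
        · obtain ⟨ha, hc⟩ := hH _ _ h
          refine ⟨a, ha, SimpleGraph.Reachable.rfl,
            (SimpleGraph.Adj.reachable (Or.inr h)).trans (SimpleGraph.Reachable.trans ?_ h2)⟩
          by_cases e : c = b
          · rw [e]
          · exact SimpleGraph.Adj.reachable (Or.inl ⟨e, hc, hb, h1⟩)
    obtain ⟨b, hb, h1, h2⟩ := key
    by_cases e : u = b
    · rw [e]; exact h2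
    · exact (SimpleGraph.Adj.reachable (Or.inl ⟨e, hu, hb, h1⟩)).trans h2

theorem reachable_map_iff {V W : Type*} (G : SimpleGraph V) (f : V ↪ W) (a b : W) :
    (G.map f).Reachable a b ↔ a = b ∨ ∃ u v, G.Reachable u v ∧ f u = a ∧ f v = b := by
  constructor
  · rintro ⟨p⟩
    induction p with
    | nil => exact Or.inl rfl
    | cons h _ ih =>
      obtain ⟨u, v, huv, rfl, rfl⟩ := (SimpleGraph.map_adj _ _ _ _).1 h
      rcases ih with rfl | ⟨u', v', h', e, rfl⟩
      · exact Or.inr ⟨u, v, huv.reachable, rfl, rfl⟩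
      · obtain rfl := f.injective e
        exact Or.inr ⟨u, v', huv.reachable.trans h', rfl, rfl⟩
  · rintro (rfl | ⟨u, v, h, rfl, rfl⟩)
    · exact SimpleGraph.Reachable.rfl
    · exact h.map (SimpleGraph.Embedding.map f G).toHom

theorem map_productGraph (α β : PartialBrauer X) {W : Type*} (f : X ⊕ X ⊕ X ↪ W) (g h : X ⊕ X ↪ W)
    (hg : ∀ a, f (Sum.map id Sum.inl a) = g a) (hh : ∀ a, f (Sum.inr a) = h a) :
    (productGraph α β).map f = α.graph.map g ⊔ β.graph.map h := by
  ext a b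
  rw [SimpleGraph.map_adj, SimpleGraph.sup_adj, SimpleGraph.map_adj, SimpleGraph.map_adj]
  simp only [productGraph_adj]
  constructor
  · rintro ⟨u, v, ⟨c, d, hcd, rfl, rfl⟩ | ⟨c, d, hcd, rfl, rfl⟩, rfl, rfl⟩
    · exact Or.inl ⟨c, d, hcd, (hg c).symm, (hg d).symm⟩
    · exact Or.inr ⟨c, d, hcd, (hh c).symm, (hh d).symm⟩
  · rintro (⟨c, d, hcd, rfl, rfl⟩ | ⟨c, d, hcd, rfl, rfl⟩)
    · exact ⟨_, _, Or.inl ⟨c, d, hcd, rfl, rfl⟩, hg c, hg d⟩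
    · exact ⟨_, _, Or.inr ⟨c, d, hcd, rfl, rfl⟩, hh c, hh d⟩

theorem map_mul (α β : PartialBrauer X) {W : Type*} (f : X ⊕ X ⊕ X ↪ W) (g : X ⊕ X ↪ W)
    (hg : ∀ a, f (outer a) = g a) (S : Set W)
    (hS : ∀ a, f a ∈ S ↔ a ∈ Set.range (outer : X ⊕ X → X ⊕ X ⊕ X)) :
    (α * β).graph.map g = contract ((productGraph α β).map f) S := by
  ext a b
  rw [SimpleGraph.map_adj]
  constructor
  · rintro ⟨u, v, ⟨hne, h⟩, rfl, rfl⟩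
    refine ⟨g.injective.ne hne, ?_, ?_, ?_⟩
    · rw [← hg, hS]; exact ⟨u, rfl⟩
    · rw [← hg, hS]; exact ⟨v, rfl⟩
    · rw [reachable_map_iff]; exact Or.inr ⟨_, _, h, hg u, hg v⟩
  · rintro ⟨hne, ha, hb, h⟩
    obtain ⟨u, v, h', rfl, rfl⟩ := ((reachable_map_iff _ f _ _).1 h).resolve_left hne
    obtain ⟨u, rfl⟩ := (hS _).1 ha
    obtain ⟨v, rfl⟩ := (hS _).1 hb
    exact ⟨u, v, ⟨fun e => hne (by rw [e]), h'⟩, (hg u).symm, (hg v).symm⟩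

theorem mul_assoc' (α β γ : PartialBrauer X) : α * β * γ = α * (β * γ) := by
  let f012 : X ⊕ X ⊕ X ↪ X ⊕ X ⊕ X ⊕ X := ⟨Sum.map id (Sum.map id Sum.inl), Sum.map_injective.2
    ⟨Function.injective_id, Sum.map_injective.2 ⟨Function.injective_id, Sum.inl_injective⟩⟩⟩
  let f123 : X ⊕ X ⊕ X ↪ X ⊕ X ⊕ X ⊕ X := ⟨Sum.inr, Sum.inr_injective⟩
  let f013 : X ⊕ X ⊕ X ↪ X ⊕ X ⊕ X ⊕ X := ⟨Sum.map id (Sum.map id Sum.inr), Sum.map_injective.2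
    ⟨Function.injective_id, Sum.map_injective.2 ⟨Function.injective_id, Sum.inr_injective⟩⟩⟩
  let f023 : X ⊕ X ⊕ X ↪ X ⊕ X ⊕ X ⊕ X := ⟨Sum.map id Sum.inr, Sum.map_injective.2
    ⟨Function.injective_id, Sum.inr_injective⟩⟩
  let e01 : X ⊕ X ↪ X ⊕ X ⊕ X ⊕ X := ⟨Sum.map id Sum.inl, Sum.map_injective.2
    ⟨Function.injective_id, Sum.inl_injective⟩⟩
  let e12 : X ⊕ X ↪ X ⊕ X ⊕ X ⊕ X := ⟨Sum.inr ∘ Sum.map id Sum.inl, Sum.inr_injective.comp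
    (Sum.map_injective.2 ⟨Function.injective_id, Sum.inl_injective⟩)⟩
  let e23 : X ⊕ X ↪ X ⊕ X ⊕ X ⊕ X := ⟨Sum.inr ∘ Sum.inr, Sum.inr_injective.comp Sum.inr_injective⟩
  let e02 : X ⊕ X ↪ X ⊕ X ⊕ X ⊕ X := ⟨Sum.map id (Sum.inr ∘ Sum.inl), Sum.map_injective.2
    ⟨Function.injective_id, Sum.inr_injective.comp Sum.inl_injective⟩⟩
  let e13 : X ⊕ X ↪ X ⊕ X ⊕ X ⊕ X := ⟨Sum.inr ∘ Sum.map id Sum.inr, Sum.inr_injective.comp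
    (Sum.map_injective.2 ⟨Function.injective_id, Sum.inr_injective⟩)⟩
  have p1 : (productGraph (α * β) γ).map f023 = (α * β).graph.map e02 ⊔ γ.graph.map e23 :=
    map_productGraph _ _ _ _ _ (by rintro (x | x) <;> rfl) (by rintro (x | x) <;> rfl)
  have p2 : (productGraph α (β * γ)).map f013 = α.graph.map e01 ⊔ (β * γ).graph.map e13 :=
    map_productGraph _ _ _ _ _ (by rintro (x | x) <;> rfl) (by rintro (x | x) <;> rfl)
  have p3 : (productGraph α β).map f012 = α.graph.map e01 ⊔ β.graph.map e12 :=
    map_productGraph _ _ _ _ _ (by rintro (x | x) <;> rfl) (by rintro (x | x) <;> rfl)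
  have p4 : (productGraph β γ).map f123 = β.graph.map e12 ⊔ γ.graph.map e23 :=
    map_productGraph _ _ _ _ _ (by rintro (x | x) <;> rfl) (by rintro (x | x) <;> rfl)
  have q1 := map_mul α β f012 e02 (by rintro (x | x) <;> rfl) (Set.range f023) (by
    rintro (x | x | x) <;> simp [f012, f023, outer])
  have q2 := map_mul β γ f123 e13 (by rintro (x | x) <;> rfl) (Set.range f013) (by
    rintro (x | x | x) <;> simp [f123, f013, outer])
  rw [q1, p3] at p1
  rw [q2, p4] at p2
  have key : ∀ {V : Type u} (G : SimpleGraph V) (f : V ↪ X ⊕ X ⊕ X ⊕ X) (a b : V),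
      G.Reachable a b ↔ (G.map f).Reachable (f a) (f b) := by
    intro V G f a b
    rw [reachable_map_iff]
    constructor
    · intro h; exact Or.inr ⟨a, b, h, rfl, rfl⟩
    · rintro (h | ⟨u, v, h, hu, hv⟩)
      · rw [f.injective h]
      · rwa [f.injective hu, f.injective hv] at h
  ext a b
  rw [mul_adj, mul_adj]
  refine and_congr_right fun _ => ?_
  have ho : ∀ c : X ⊕ X, f013 (outer c) = f023 (outer c) := by rintro (x | x) <;> rfl
  rw [key _ f023, key _ f013, p1, p2, ho, ho, sup_comm _ (contract _ (Set.range f013)),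
    reachable_contract, reachable_contract]
  · rw [sup_comm _ (α.graph.map e01), sup_assoc]
  · rintro _ _ h
    obtain ⟨u, v, -, rfl, rfl⟩ := (SimpleGraph.map_adj _ _ _ _).1 h
    rcases u with u | u <;> rcases v with v | v <;> simp [f013, e01]
  · rw [← ho]; exact ⟨_, rfl⟩
  · rw [← ho]; exact ⟨_, rfl⟩
  · rintro _ _ h
    obtain ⟨u, v, -, rfl, rfl⟩ := (SimpleGraph.map_adj _ _ _ _).1 h
    rcases u with u | u <;> rcases v with v | v <;> simp [f023, e23]
  · exact ⟨_, rfl⟩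
  · exact ⟨_, rfl⟩

/-- The partial Brauer monoid. -/
instance : Monoid (PartialBrauer X) where
  mul_assoc := mul_assoc'
  one_mul := one_mul'
  mul_one := mul_one'

/-- The number of transversals `{x, y'}`. -/
noncomputable def t (α : PartialBrauer X) : Cardinal.{u} :=
  #{p : X × X // α.graph.Adj (Sum.inl p.1) (Sum.inr p.2)}

/-- The number of upper hooks `{x, y}`. -/
noncomputable def h (α : PartialBrauer X) : Cardinal.{u} :=
  #{e : Sym2 X // e.map Sum.inl ∈ α.graph.edgeSet}

/-- The number of lower hooks `{x', y'}`. -/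
noncomputable def hStar (α : PartialBrauer X) : Cardinal.{u} :=
  #{e : Sym2 X // e.map Sum.inr ∈ α.graph.edgeSet}

/-- The number of upper singletons `{x}`. -/
noncomputable def s (α : PartialBrauer X) : Cardinal.{u} :=
  #{x : X // ∀ v, ¬ α.graph.Adj (Sum.inl x) v}

/-- The number of lower singletons `{x'}`. -/
noncomputable def sStar (α : PartialBrauer X) : Cardinal.{u} :=
  #{x : X // ∀ v, ¬ α.graph.Adj (Sum.inr x) v}

end PartialBrauer

/-- The set of (two-sided) units of a monoid. -/
def unitSet (M : Type u) [Monoid M] : Set M := {g | IsUnit g}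

/-- The subsemigroup generated by the idempotents and the units of a monoid. -/
def idempotentUnitGenerated (M : Type u) [Monoid M] : Subsemigroup M :=
  Subsemigroup.closure ({e | e * e = e} ∪ unitSet M)

/-- The relative rank of a subsemigroup `T` modulo a subset `A` of `T`: the least cardinality of
a set `U ⊆ T` such that `A ∪ U` generates `T`.  The set of cardinals is not empty, as `U = T` is
allowed, so the minimum is attained. -/
noncomputable def relativeRank {M : Type u} [Semigroup M] (T : Subsemigroup M) (A : Set M) :
    Cardinal.{u} :=
  sInf {c | ∃ U : Set M, U ⊆ T ∧ Subsemigroup.closure (A ∪ U) = T ∧ #U = c}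

/-- The number of infinite cardinals not exceeding `|X|`. -/
noncomputable def infiniteCardinalsLE (X : Type u) : Cardinal.{u + 1} :=
  #{μ : Cardinal.{u} // ℵ₀ ≤ μ ∧ μ ≤ #X}

/-- The sets `Ω = {α_μ, β_μ | μ = 1 or ℵ₀ ≤ μ ≤ |X|}` of elements of the submonoid generated by
idempotents and units, whose members have the prescribed parameters.  (These parameters force
all the `α_μ` and `β_μ` to be distinct.) -/
def IsStandardFamily {X : Type u} (Ω : Set (PartialBrauer X)) : Prop :=
  ∃ α β : {μ : Cardinal.{u} // μ = 1 ∨ (ℵ₀ ≤ μ ∧ μ ≤ #X)} → PartialBrauer X,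
    Ω = Set.range α ∪ Set.range β ∧
    Ω ⊆ idempotentUnitGenerated (PartialBrauer X) ∧
    ∀ μ, (α μ).t = #X ∧ (β μ).t = #X ∧
      (α μ).s < μ ∧ (α μ).h = μ ∧
      (β μ).h < μ ∧ (β μ).s = μ ∧
      (((α μ).sStar < μ ∧ (α μ).hStar = μ ∧ (β μ).hStar < μ ∧ (β μ).sStar = μ) ∨
        ((α μ).hStar < μ ∧ (α μ).sStar = μ ∧ (β μ).sStar < μ ∧ (β μ).hStar = μ))

/-! Call the number of upper vertices on no transversal the defect of `α`; it equals `s + 2h`. The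
generated submonoid is the set of `α` whose upper and lower defects agree
(`mem_idempotentUnitGenerated`). Idempotents and units are balanced in this sense and products
preserve it. Conversely, multiplying by units on both sides identifies all elements with the same
five parameters (`exists_isUnit_mul_mul`), and every balanced choice of parameters is realised by an
idempotent. Generation modulo units thus becomes arithmetic with five cardinals, governed by
`exists_hasParams_mul`.

Necessity: let `μ` be `1` or infinite, and factor an idempotent of rank `|X|` with `μ` hooks and no
singletons in each row. Sets of fewer than `μ` points are negligible, as sums of two cardinals below
`μ` stay below `μ`. So some generator outside the units has rank `|X|`, exactly `μ` upper hooks and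
fewer upper singletons (`exists_of_mem_closure`, `exists_upper`). Exchanging hooks with singletons
and upper with lower rows gives the four conditions of `HasExtremal`. The two upper ones already
require two distinct generators for each `μ`, which is the lower bound.

Sufficiency: from `HasExtremal`, induction on `d` yields rows with `d` hooks only and with `d`
singletons only (`HasExtremal.rows`). Such rows can be added, and any upper row can be joined to any
lower row of the same defect. This reaches every balanced element of rank `|X|`, and each element of
smaller rank is a product of two of those (`HasExtremal.mem`).

For the classification with finite `ρ`, a generating set of the minimal size consists of the upper
witnesses alone. The lower witnesses are among them, and equality of defects forces a lower witness
of level `μ` to be `α_μ` or `β_μ`. The two ways to assign them are the two alternatives of the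
statement. -/

/-! ### Comparing cardinals by relations; sets closed under adjacency. -/

theorem Cardinal.mk_le_of_rel {A B : Type u} (R : A → B → Prop) (h : ∀ a, ∃ b, R a b)
    (hR : ∀ a a' b, R a b → R a' b → a = a') : #A ≤ #B := by
  choose f hf using h
  exact mk_le_of_injective (f := f) fun a a' e => hR a a' (f a) (hf a) (e ▸ hf a')

theorem Cardinal.mk_le_add_of_rel {A B C : Type u} (R : A → B → Prop) (Q : A → C → Prop)
    (h : ∀ a, (∃ b, R a b) ∨ ∃ c, Q a c)
    (hR : ∀ a a' b, R a b → R a' b → a = a') (hQ : ∀ a a' c, Q a c → Q a' c → a = a') :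
    #A ≤ #B + #C := by
  rw [add_def]
  refine mk_le_of_rel (fun a => Sum.elim (R a) (Q a)) ?_ ?_
  · intro a
    rcases h a with ⟨b, hb⟩ | ⟨c, hc⟩
    · exact ⟨Sum.inl b, hb⟩
    · exact ⟨Sum.inr c, hc⟩
  · rintro a a' (b | c) h1 h2
    · exact hR a a' b h1 h2
    · exact hQ a a' c h1 h2

theorem SimpleGraph.Reachable.mem_of_closed {V : Type*} {G : SimpleGraph V} {S : Set V}
    (hS : ∀ a ∈ S, ∀ b, G.Adj a b → b ∈ S) {a b : V} (h : G.Reachable a b) (ha : a ∈ S) :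
    b ∈ S := by
  obtain ⟨p⟩ := h
  induction p with
  | nil => exact ha
  | cons h _ ih => exact ih (hS _ ha _ h)

/-! ### The flip of a Brauer graph and the local structure of products. -/

namespace PartialBrauer

variable {X : Type u}

/-- The anti-involution that turns a Brauer graph upside down. -/
def star (α : PartialBrauer X) : PartialBrauer X where
  graph := α.graph.comap Sum.swap
  eq_of_adj _ _ _ h h' := Sum.swap_leftInverse.injective (α.eq_of_adj _ _ _ h h')

theorem star_adj (α : PartialBrauer X) (a b : X ⊕ X) :
    (star α).graph.Adj a b ↔ α.graph.Adj a.swap b.swap := Iff.rfl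

theorem star_star (α : PartialBrauer X) : star (star α) = α := by
  ext a b
  simp [star_adj]

theorem reachable_flip (α β : PartialBrauer X) {a b : X ⊕ X}
    (h : (productGraph α β).Reachable (outer a) (outer b)) :
    (productGraph (star β) (star α)).Reachable (outer a.swap) (outer b.swap) := by
  have key := reachable_collapse (H := productGraph (star β) (star α))
    (Sum.elim (fun x => Sum.inr (Sum.inr x))
      (Sum.elim (fun x => Sum.inr (Sum.inl x)) (fun x => Sum.inl x))) (by
        intro a b hab
        right
        rw [productGraph_adj] at hab ⊢
        rcases hab with ⟨u, v, huv, rfl, rfl⟩ | ⟨u, v, huv, rfl, rfl⟩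
        · refine Or.inr ⟨u.swap, v.swap, by simpa [star_adj] using huv, ?_, ?_⟩
          · rcases u with u | u <;> rfl
          · rcases v with v | v <;> rfl
        · refine Or.inl ⟨u.swap, v.swap, by simpa [star_adj] using huv, ?_, ?_⟩
          · rcases u with u | u <;> rfl
          · rcases v with v | v <;> rfl) h
  rcases a with a | a <;> rcases b with b | b <;> exact key

theorem star_mul (α β : PartialBrauer X) : star (α * β) = star β * star α := by
  ext a b
  rw [star_adj, mul_adj, mul_adj]
  refine and_congr (Sum.swap_leftInverse.injective.ne_iff) ⟨fun h => ?_, fun h => ?_⟩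
  · simpa using reachable_flip α β h
  · simpa [star_star] using reachable_flip (star β) (star α) h

section Product

variable (α β : PartialBrauer X)

theorem adj_left {u v : X ⊕ X} (h : α.graph.Adj u v) :
    (productGraph α β).Adj (Sum.map id Sum.inl u) (Sum.map id Sum.inl v) :=
  (productGraph_adj _ _ _ _).2 (Or.inl ⟨u, v, h, rfl, rfl⟩)

theorem adj_right {u v : X ⊕ X} (h : β.graph.Adj u v) :
    (productGraph α β).Adj (Sum.inr u) (Sum.inr v) :=
  (productGraph_adj _ _ _ _).2 (Or.inr ⟨u, v, h, rfl, rfl⟩)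

variable {α β}

theorem mul_upper_hook {x y : X} (h : α.graph.Adj (Sum.inl x) (Sum.inl y)) :
    (α * β).graph.Adj (Sum.inl x) (Sum.inl y) :=
  ⟨h.ne, (adj_left α β h).reachable⟩

theorem mul_lower_hook {x y : X} (h : β.graph.Adj (Sum.inr x) (Sum.inr y)) :
    (α * β).graph.Adj (Sum.inr x) (Sum.inr y) :=
  ⟨h.ne, (adj_right α β h).reachable⟩

theorem mul_transversal {x y z : X} (h : α.graph.Adj (Sum.inl x) (Sum.inr y))
    (h' : β.graph.Adj (Sum.inl y) (Sum.inr z)) : (α * β).graph.Adj (Sum.inl x) (Sum.inr z) :=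
  ⟨by simp, (adj_left α β h).reachable.trans (adj_right α β h').reachable⟩

theorem mul_upper_hook_of_hook {x y z w : X} (h : α.graph.Adj (Sum.inl x) (Sum.inr y))
    (h' : β.graph.Adj (Sum.inl y) (Sum.inl z)) (h'' : α.graph.Adj (Sum.inl w) (Sum.inr z)) :
    (α * β).graph.Adj (Sum.inl x) (Sum.inl w) := by
  refine ⟨?_, ((adj_left α β h).reachable.trans (adj_right α β h').reachable).trans
    (adj_left α β h'').symm.reachable⟩
  rintro e
  obtain rfl := Sum.inl_injective e
  have := α.eq_of_adj _ _ _ h h''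
  exact h'.ne (by simpa using this)

theorem mul_lower_hook_of_hook {x y z w : X} (h : β.graph.Adj (Sum.inl x) (Sum.inr y))
    (h' : α.graph.Adj (Sum.inr x) (Sum.inr z)) (h'' : β.graph.Adj (Sum.inl z) (Sum.inr w)) :
    (α * β).graph.Adj (Sum.inr y) (Sum.inr w) := by
  have := mul_upper_hook_of_hook (α := star β) (β := star α) (x := y) (y := x) (z := z) (w := w)
    h.symm h' h''.symm
  rwa [← star_mul] at this

theorem mul_upper_single {x : X} (h : ∀ v, ¬ α.graph.Adj (Sum.inl x) v) (v : X ⊕ X) :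
    ¬ (α * β).graph.Adj (Sum.inl x) v := by
  rintro ⟨hne, hr⟩
  refine hne (outer_injective (Eq.symm ?_))
  refine hr.mem_of_closed (S := {outer (Sum.inl x)}) ?_ rfl
  rintro _ rfl b hb
  rw [productGraph_adj] at hb
  rcases hb with ⟨a | a, c, hac, e, -⟩ | ⟨a, c, hac, e, -⟩
  · simp only [Sum.map_inl, outer, id] at e
    obtain rfl := Sum.inl_injective e
    exact absurd hac (h _)
  · simp [outer] at e
  · simp [outer] at e

theorem mul_upper_single_of_single {x y : X} (hxy : α.graph.Adj (Sum.inl x) (Sum.inr y))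
    (h : ∀ v, ¬ β.graph.Adj (Sum.inl y) v) (v : X ⊕ X) :
    ¬ (α * β).graph.Adj (Sum.inl x) v := by
  rintro ⟨hne, hr⟩
  have hv : outer v ∈ ({Sum.inl x, Sum.inr (Sum.inl y)} : Set (X ⊕ X ⊕ X)) := by
    refine hr.mem_of_closed ?_ (Or.inl rfl)
    rintro _ (rfl | rfl) b hb
    · obtain rfl := productGraph_outer α β (Sum.inl x) hb (adj_left α β hxy)
      exact Or.inr rfl
    · rw [productGraph_adj] at hb
      rcases hb with ⟨a | a, c, hac, e, rfl⟩ | ⟨a, c, hac, e, rfl⟩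
      · simp at e
      · simp only [Sum.map_inr, Sum.inr.injEq, Sum.inl.injEq] at e
        subst e
        obtain rfl := α.eq_of_adj _ _ _ hac hxy.symm
        exact Or.inl rfl
      · obtain rfl := Sum.inr_injective e
        exact absurd hac (h _)
  rcases v with v | v
  · refine hne ?_
    simpa [outer, eq_comm] using hv
  · simp [outer] at hv

theorem mul_lower_single {x : X} (h : ∀ v, ¬ β.graph.Adj (Sum.inr x) v) (v : X ⊕ X) :
    ¬ (α * β).graph.Adj (Sum.inr x) v := by
  have := mul_upper_single (α := star β) (β := star α) (x := x) (fun v => h v.swap) v.swap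
  rw [← star_mul, star_adj] at this
  simpa using this

theorem mul_lower_single_of_single {x y : X} (hxy : β.graph.Adj (Sum.inl x) (Sum.inr y))
    (h : ∀ v, ¬ α.graph.Adj (Sum.inr x) v) (v : X ⊕ X) :
    ¬ (α * β).graph.Adj (Sum.inr y) v := by
  have := mul_upper_single_of_single (α := star β) (β := star α) (x := y) (y := x) hxy.symm
    (fun v => h v.swap) v.swap
  rw [← star_mul, star_adj] at this
  simpa using this

/-- Degrees are at most one, so an extra edge of `δ` would have to start at a vertex isolated in
`γ`. A product is therefore identified by exhibiting the expected edges and isolated vertices,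
without analysing all paths. -/
theorem eq_of_le_of_isolated {γ δ : PartialBrauer X}
    (hadj : ∀ a b, γ.graph.Adj a b → δ.graph.Adj a b)
    (hiso : ∀ a, (∀ b, ¬ γ.graph.Adj a b) → ∀ b, ¬ δ.graph.Adj a b) : δ = γ := by
  ext a b
  refine ⟨fun h => ?_, hadj a b⟩
  by_contra hn
  by_cases ha : ∃ c, γ.graph.Adj a c
  · obtain ⟨c, hc⟩ := ha
    obtain rfl := δ.eq_of_adj _ _ _ h (hadj _ _ hc)
    exact hn hc
  · exact hiso a (not_exists.1 ha) b h

end Product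

/-! ### Transversals, the defect, and how the parameters change in a product. -/

/-- The upper vertices of the transversals. -/
def dom (α : PartialBrauer X) : Set X := {x | ∃ y, α.graph.Adj (Sum.inl x) (Sum.inr y)}

theorem mem_dom_star {α : PartialBrauer X} {y : X} :
    y ∈ dom (star α) ↔ ∃ x, α.graph.Adj (Sum.inl x) (Sum.inr y) :=
  exists_congr fun _ => SimpleGraph.adj_comm _ _ _

theorem mul_dom_left {α β : PartialBrauer X} {x : X} (h : x ∈ dom (α * β)) : x ∈ dom α := by
  obtain ⟨w, hw⟩ := h
  by_contra hx
  by_cases h' : ∃ v, α.graph.Adj (Sum.inl x) v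
  · obtain ⟨v | v, hv⟩ := h'
    · have := (α * β).eq_of_adj _ _ _ hw (mul_upper_hook hv)
      simp at this
    · exact hx ⟨v, hv⟩
  · exact mul_upper_single (not_exists.1 h') _ hw

theorem upper_unique {α : PartialBrauer X} {x y z : X} (h : α.graph.Adj (Sum.inl x) (Sum.inr y))
    (h' : α.graph.Adj (Sum.inl x) (Sum.inr z)) : y = z :=
  Sum.inr_injective (α.eq_of_adj _ _ _ h h')

theorem lower_unique {α : PartialBrauer X} {x y z : X} (h : α.graph.Adj (Sum.inl x) (Sum.inr z))
    (h' : α.graph.Adj (Sum.inl y) (Sum.inr z)) : x = y :=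
  Sum.inl_injective (α.eq_of_adj _ _ _ h.symm h'.symm)

/-- The number of upper vertices that lie on no transversal. -/
noncomputable def defect (α : PartialBrauer X) : Cardinal.{u} := #↥(dom α)ᶜ

theorem t_eq_mk_dom (α : PartialBrauer X) : α.t = #(dom α) := by
  apply le_antisymm
  · refine mk_le_of_rel (fun p x => p.1.1 = x.1) (fun p => ⟨⟨p.1.1, p.1.2, p.2⟩, rfl⟩) ?_
    rintro ⟨⟨x, y⟩, h⟩ ⟨⟨x', y'⟩, h'⟩ ⟨z, hz⟩ e e'
    obtain rfl : x = z := e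
    obtain rfl : x' = x := e'
    obtain rfl := upper_unique h h'
    rfl
  · refine mk_le_of_rel (fun x p => p.1.1 = x.1) (fun x => ⟨⟨(x.1, x.2.choose),
      x.2.choose_spec⟩, rfl⟩) ?_
    rintro ⟨x, hx⟩ ⟨y, hy⟩ p h1 h2
    exact Subtype.ext (h1.symm.trans h2)

theorem t_star (α : PartialBrauer X) : (star α).t = α.t :=
  mk_congr ((Equiv.prodComm X X).subtypeEquiv fun _ => SimpleGraph.adj_comm _ _ _)

theorem s_star (α : PartialBrauer X) : (star α).s = α.sStar :=
  mk_congr (Equiv.subtypeEquivRight fun x =>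
    ⟨fun h v => by simpa [star_adj] using h v.swap, fun h v => h v.swap⟩)

theorem h_star (α : PartialBrauer X) : (star α).h = α.hStar :=
  mk_congr (Equiv.subtypeEquivRight fun e => by
    induction e using Sym2.ind with
    | _ x y => rfl)

theorem mk_compl_dom (α : PartialBrauer X) : α.t + defect α = #X := by
  rw [t_eq_mk_dom, defect, mk_sum_compl]

theorem t_le (α : PartialBrauer X) : α.t ≤ #X := by
  rw [← mk_compl_dom α]; exact self_le_add_right _ _

theorem defect_le (α : PartialBrauer X) : defect α ≤ #X := mk_set_le _

theorem t_mul_le_left (α β : PartialBrauer X) : (α * β).t ≤ α.t := by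
  rw [t_eq_mk_dom, t_eq_mk_dom]
  exact mk_le_mk_of_subset fun _ => mul_dom_left

theorem t_mul_le_right (α β : PartialBrauer X) : (α * β).t ≤ β.t := by
  rw [← t_star, star_mul, ← t_star β]
  exact t_mul_le_left _ _

theorem s_le_mul (α β : PartialBrauer X) : α.s ≤ (α * β).s :=
  mk_le_mk_of_subset (s := {x | ∀ v, ¬ α.graph.Adj (Sum.inl x) v})
    (t := {x | ∀ v, ¬ (α * β).graph.Adj (Sum.inl x) v}) fun _ => mul_upper_single

theorem h_le_mul (α β : PartialBrauer X) : α.h ≤ (α * β).h := by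
  refine mk_le_mk_of_subset (s := {e : Sym2 X | e.map Sum.inl ∈ α.graph.edgeSet})
    (t := {e : Sym2 X | e.map Sum.inl ∈ (α * β).graph.edgeSet}) fun e => ?_
  induction e using Sym2.ind with
  | _ x y => exact fun h => mul_upper_hook h

/-- An upper singleton of `β` is pulled back along a transversal of `α` to an upper singleton of the
product, unless it sits at a lower vertex of `α` on no transversal. -/
theorem s_le_mul_add (α β : PartialBrauer X) : β.s ≤ (α * β).s + defect (star α) := by
  refine mk_le_add_of_rel (fun z x => α.graph.Adj (Sum.inl x.1) (Sum.inr z.1))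
    (fun z y => z.1 = y.1) ?_ ?_ ?_
  · rintro ⟨z, hz⟩
    by_cases h : z ∈ dom (star α)
    · obtain ⟨x, hx⟩ := mem_dom_star.1 h
      exact Or.inl ⟨⟨x, mul_upper_single_of_single hx hz⟩, hx⟩
    · exact Or.inr ⟨⟨z, h⟩, rfl⟩
  · exact fun z z' x h1 h2 => Subtype.ext (upper_unique h1 h2)
  · exact fun z z' x h1 h2 => Subtype.ext (h1.trans h2.symm)

/-- A hook of `β` with both ends on transversals of `α` pulls back to a hook. Any other hook is
charged to an end off the transversals; hooks are disjoint, so no vertex is charged twice. -/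
theorem h_le_mul_add (α β : PartialBrauer X) : β.h ≤ (α * β).h + defect (star α) := by
  refine mk_le_add_of_rel (fun e f => ∃ x y z w, e.1 = s(x, y) ∧ f.1 = s(z, w) ∧
      α.graph.Adj (Sum.inl z) (Sum.inr x) ∧ α.graph.Adj (Sum.inl w) (Sum.inr y))
    (fun e y => y.1 ∈ e.1) ?_ ?_ ?_
  · rintro ⟨e, he⟩
    induction e using Sym2.ind with
    | _ x y =>
      by_cases hx : x ∈ dom (star α)
      · by_cases hy : y ∈ dom (star α)
        · obtain ⟨z, hz⟩ := mem_dom_star.1 hx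
          obtain ⟨w, hw⟩ := mem_dom_star.1 hy
          exact Or.inl ⟨⟨s(z, w), mul_upper_hook_of_hook hz he hw⟩, x, y, z, w, rfl, rfl, hz, hw⟩
        · exact Or.inr ⟨⟨y, hy⟩, Sym2.mem_mk_right x y⟩
      · exact Or.inr ⟨⟨x, hx⟩, Sym2.mem_mk_left x y⟩
  · rintro ⟨e, he⟩ ⟨e', he'⟩ f ⟨x, y, z, w, rfl, h2, h3, h4⟩ ⟨x', y', z', w', rfl, h2', h3', h4'⟩
    rw [h2, Sym2.eq_iff] at h2'
    rcases h2' with ⟨rfl, rfl⟩ | ⟨rfl, rfl⟩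
    · simp [upper_unique h3 h3', upper_unique h4 h4']
    · simp [upper_unique h3 h4', upper_unique h4 h3', Sym2.eq_swap]
  · rintro ⟨e, he⟩ ⟨e', he'⟩ ⟨y, hy⟩ h1 h2
    obtain ⟨z, rfl⟩ := h1
    obtain ⟨w, rfl⟩ := h2
    have := Sum.inl_injective (β.eq_of_adj _ _ _ he he')
    subst this
    rfl

theorem mk_dom_diff_le (α β : PartialBrauer X) : #↥(dom α \ dom (α * β)) ≤ defect β := by
  refine mk_le_of_rel (fun x y => α.graph.Adj (Sum.inl x.1) (Sum.inr y.1)) ?_ ?_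
  · rintro ⟨x, ⟨y, hy⟩, hx⟩
    exact ⟨⟨y, fun ⟨z, hz⟩ => hx ⟨z, mul_transversal hy hz⟩⟩, hy⟩
  · exact fun z z' x h1 h2 => Subtype.ext (lower_unique h1 h2)

theorem defect_mul_eq (α β : PartialBrauer X) :
    defect (α * β) = defect α + #↥(dom α \ dom (α * β)) := by
  rw [defect, defect, ← mk_union_of_disjoint]
  · congr 2
    ext x
    simp only [Set.mem_compl_iff, Set.mem_union, Set.mem_sdiff]
    have := fun h : x ∈ dom (α * β) => mul_dom_left h
    tauto
  · exact Set.disjoint_left.2 fun x h1 h2 => h1 h2.1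

theorem defect_mul_le (α β : PartialBrauer X) : defect (α * β) ≤ defect α + defect β := by
  rw [defect_mul_eq]
  gcongr
  exact mk_dom_diff_le α β

/-! ### Balanced defects are preserved by products. -/

/-- The lower vertices of those transversals of `α` that extend to transversals of `α * β`. -/
def midLeft (α β : PartialBrauer X) : Set X :=
  {y | ∃ x w, α.graph.Adj (Sum.inl x) (Sum.inr y) ∧ (α * β).graph.Adj (Sum.inl x) (Sum.inr w)}

/-- The upper vertices of those transversals of `β` that extend to transversals of `α * β`. -/
def midRight (α β : PartialBrauer X) : Set X :=
  {z | ∃ x w, β.graph.Adj (Sum.inl z) (Sum.inr w) ∧ (α * β).graph.Adj (Sum.inl x) (Sum.inr w)}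

theorem midLeft_star (α β : PartialBrauer X) : midLeft (star β) (star α) = midRight α β := by
  ext z
  simp only [midLeft, midRight, Set.mem_ofPred_eq, ← star_mul, star_adj, Sum.swap_inl, Sum.swap_inr]
  rw [exists_comm]
  simp only [SimpleGraph.adj_comm _ (Sum.inr _) (Sum.inl _)]

/-- Following the transversals of `α * β` gives a bijection from `midLeft` to `midRight`. It fixes
every point of the intersection, because a transversal of `α` meeting one of `β` continues directly
along it. Hence the two set differences are equinumerous, and so are the complements; a mere
bijection between infinite sets would not give this. -/
theorem mk_compl_midLeft_le (α β : PartialBrauer X) :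
    #↥(midLeft α β)ᶜ ≤ #↥(midRight α β)ᶜ := by
  have key : ∀ {x y z w : X}, α.graph.Adj (Sum.inl x) (Sum.inr y) →
      (α * β).graph.Adj (Sum.inl x) (Sum.inr w) → β.graph.Adj (Sum.inl z) (Sum.inr w) →
      y ∈ midRight α β → y = z := by
    rintro x y z w h1 h2 h3 ⟨x', w', h4, -⟩
    obtain rfl := upper_unique h2 (mul_transversal h1 h4)
    exact lower_unique h4 h3
  refine mk_le_of_rel (fun y z => (y.1 = z.1 ∧ y.1 ∉ midRight α β) ∨
    ∃ x w, α.graph.Adj (Sum.inl x) (Sum.inr z.1) ∧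
      (α * β).graph.Adj (Sum.inl x) (Sum.inr w) ∧ β.graph.Adj (Sum.inl y.1) (Sum.inr w)) ?_ ?_
  · rintro ⟨y, hy⟩
    by_cases h : y ∈ midRight α β
    · obtain ⟨x, w, h1, h2⟩ := h
      obtain ⟨z, hz⟩ := mul_dom_left ⟨w, h2⟩
      refine ⟨⟨z, fun h' => hy ?_⟩, Or.inr ⟨x, w, hz, h2, h1⟩⟩
      obtain rfl := key hz h2 h1 h'
      exact ⟨x, w, hz, h2⟩
    · exact ⟨⟨y, h⟩, Or.inl ⟨rfl, h⟩⟩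
  · rintro ⟨y, hy⟩ ⟨y', hy'⟩ ⟨z, hz⟩ h1 h2
    rcases h1 with ⟨rfl, h1⟩ | ⟨x, w, h1, h2', h3⟩ <;>
    rcases h2 with ⟨rfl, h2⟩ | ⟨x', w', h4, h5, h6⟩
    · rfl
    · exact absurd ⟨x', w', h4, h5⟩ hy
    · exact absurd ⟨x, w, h1, h2'⟩ hy'
    · obtain rfl := lower_unique h1 h4
      obtain rfl := upper_unique h2' h5
      exact Subtype.ext (lower_unique h3 h6)

theorem mk_compl_midLeft (α β : PartialBrauer X) :
    #↥(midLeft α β)ᶜ = #↥(midRight α β)ᶜ := by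
  refine le_antisymm (mk_compl_midLeft_le α β) ?_
  have := mk_compl_midLeft_le (star β) (star α)
  rwa [midLeft_star, ← midLeft_star (star β) (star α), star_star, star_star] at this

theorem mk_compl_midLeft_eq (α β : PartialBrauer X) :
    #↥(midLeft α β)ᶜ = defect (star α) + #↥(dom α \ dom (α * β)) := by
  have h1 : #↥(dom α \ dom (α * β)) = #↥(dom (star α) \ midLeft α β) := by
    apply le_antisymm
    · refine mk_le_of_rel (fun x y => α.graph.Adj (Sum.inl x.1) (Sum.inr y.1)) ?_ ?_
      · rintro ⟨x, ⟨y, hy⟩, hx⟩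
        refine ⟨⟨y, mem_dom_star.2 ⟨x, hy⟩, ?_⟩, hy⟩
        rintro ⟨x', w, h1, h2⟩
        obtain rfl := lower_unique hy h1
        exact hx ⟨w, h2⟩
      · exact fun z z' x h1 h2 => Subtype.ext (lower_unique h1 h2)
    · refine mk_le_of_rel (fun y x => α.graph.Adj (Sum.inl x.1) (Sum.inr y.1)) ?_ ?_
      · rintro ⟨y, hy, hx⟩
        obtain ⟨x, hxy⟩ := mem_dom_star.1 hy
        exact ⟨⟨x, ⟨y, hxy⟩, fun ⟨w, hw⟩ => hx ⟨x, w, hxy, hw⟩⟩, hxy⟩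
      · exact fun z z' x h1 h2 => Subtype.ext (upper_unique h1 h2)
  rw [h1, defect, ← mk_union_of_disjoint]
  · congr 2
    ext x
    simp only [Set.mem_compl_iff, Set.mem_union, Set.mem_sdiff]
    have : x ∈ midLeft α β → x ∈ dom (star α) := by
      rintro ⟨y, w, h, -⟩
      exact mem_dom_star.2 ⟨y, h⟩
    tauto
  · exact Set.disjoint_left.2 fun x h1 h2 => h1 h2.1

/-- On each side, the defect of the product is the defect of the outer factor plus the number of its
transversals that are lost. With balanced factors these sums are the sizes of the complements of
`midLeft` and `midRight`, which agree. -/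
theorem defect_star_mul {α β : PartialBrauer X} (hα : defect (star α) = defect α)
    (hβ : defect (star β) = defect β) : defect (star (α * β)) = defect (α * β) := by
  have h1 := mk_compl_midLeft_eq α β
  have h2 := mk_compl_midLeft_eq (star β) (star α)
  rw [midLeft_star, star_star, ← mk_compl_midLeft, ← star_mul] at h2
  rw [star_mul, defect_mul_eq, ← star_mul, hβ, ← h2, defect_mul_eq, ← hα, h1]

/-- In `α * α = α` every transversal survives, so `midLeft` and `midRight` are all of the lower and
upper transversal vertices. -/
theorem defect_star_of_idempotent {α : PartialBrauer X} (h : α * α = α) :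
    defect (star α) = defect α := by
  have h1 := mk_compl_midLeft α α
  have h2 : midLeft α α = dom (star α) := by
    ext y
    simp only [midLeft, h, mem_dom_star, Set.mem_ofPred_eq]
    exact ⟨fun ⟨x, w, h1, _⟩ => ⟨x, h1⟩, fun ⟨x, h1⟩ => ⟨x, y, h1, h1⟩⟩
  have h3 : midRight α α = dom α := by
    ext y
    simp only [midRight, h, dom, Set.mem_ofPred_eq]
    exact ⟨fun ⟨x, w, h1, _⟩ => ⟨w, h1⟩, fun ⟨x, h1⟩ => ⟨y, x, h1, h1⟩⟩
  rw [h2, h3] at h1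
  exact h1

theorem defect_one : defect (1 : PartialBrauer X) = 0 := by
  rw [defect, mk_eq_zero_iff]
  exact ⟨fun x => x.2 ⟨x.1, rfl⟩⟩

theorem star_one : star (1 : PartialBrauer X) = 1 := by
  ext a b
  rw [star_adj, one_adj, one_adj]
  cases a <;> cases b <;> simp

theorem defect_of_isUnit {α : PartialBrauer X} (h : IsUnit α) : defect α = 0 := by
  obtain ⟨β, hβ⟩ := h.exists_right_inv
  have := defect_mul_eq α β
  rw [hβ, defect_one] at this
  exact (add_eq_zero.1 this.symm).1

theorem isUnit_star {α : PartialBrauer X} (h : IsUnit α) : IsUnit (star α) := by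
  obtain ⟨β, hβ⟩ := h.exists_right_inv
  obtain ⟨γ, hγ⟩ := h.exists_left_inv
  refine isUnit_iff_exists_and_exists.2 ⟨⟨star γ, ?_⟩, ⟨star β, ?_⟩⟩
  · rw [← star_mul, hγ, star_one]
  · rw [← star_mul, hβ, star_one]

end PartialBrauer

namespace PartialBrauer

variable {X : Type u}

/-! ### Normal forms: a Brauer graph as two labelled rows. -/

section NormalForm

variable {T S H S' H' : Type u}

/-- The Brauer graph with transversals indexed by `T`, upper singletons and hooks indexed by `S`
and `H`, and lower singletons and hooks indexed by `S'` and `H'`. -/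
def ofRows (f : X ≃ T ⊕ S ⊕ H × Bool) (g : X ≃ T ⊕ S' ⊕ H' × Bool) : PartialBrauer X where
  graph :=
    { Adj := fun
        | .inl x, .inl y => ∃ h b, f x = .inr (.inr (h, b)) ∧ f y = .inr (.inr (h, !b))
        | .inl x, .inr y => ∃ t, f x = .inl t ∧ g y = .inl t
        | .inr y, .inl x => ∃ t, f x = .inl t ∧ g y = .inl t
        | .inr x, .inr y => ∃ h b, g x = .inr (.inr (h, b)) ∧ g y = .inr (.inr (h, !b))
      symm := ⟨by
        rintro (x | x) (y | y)
        · rintro ⟨h, b, h1, h2⟩; exact ⟨h, !b, h2, by simpa using h1⟩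
        · exact id
        · exact id
        · rintro ⟨h, b, h1, h2⟩; exact ⟨h, !b, h2, by simpa using h1⟩⟩
      loopless := ⟨by
        rintro (x | x)
        · rintro ⟨h, b, h1, h2⟩; rw [h1] at h2; simp at h2
        · rintro ⟨h, b, h1, h2⟩; rw [h1] at h2; simp at h2⟩ }
  eq_of_adj := by
    rintro (x | x) (y | y) (z | z)
    · rintro ⟨h, b, h1, h2⟩ ⟨h', b', h3, h4⟩
      rw [h1] at h3; simp at h3; rw [← h3.1, ← h3.2, ← h2] at h4
      rw [f.injective h4]
    · rintro ⟨h, b, h1, h2⟩ ⟨t, h3, h4⟩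
      rw [h1] at h3; simp at h3
    · rintro ⟨t, h3, h4⟩ ⟨h, b, h1, h2⟩
      rw [h1] at h3; simp at h3
    · rintro ⟨t, h3, h4⟩ ⟨t', h1, h2⟩
      rw [h1] at h3; simp at h3; rw [← h3, ← h2] at h4
      rw [g.injective h4]
    · rintro ⟨t, h3, h4⟩ ⟨t', h1, h2⟩
      rw [h2] at h4; simp at h4; rw [← h4, ← h1] at h3
      rw [f.injective h3]
    · rintro ⟨t, h4, h3⟩ ⟨h, b, h1, h2⟩
      rw [h1] at h3; simp at h3
    · rintro ⟨h, b, h1, h2⟩ ⟨t, h4, h3⟩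
      rw [h1] at h3; simp at h3
    · rintro ⟨h, b, h1, h2⟩ ⟨h', b', h3, h4⟩
      rw [h1] at h3; simp at h3; rw [← h3.1, ← h3.2, ← h2] at h4
      rw [g.injective h4]

variable (f : X ≃ T ⊕ S ⊕ H × Bool) (g : X ≃ T ⊕ S' ⊕ H' × Bool)

theorem ofRows_upper {x y : X} : (ofRows f g).graph.Adj (.inl x) (.inl y) ↔
    ∃ h b, f x = .inr (.inr (h, b)) ∧ f y = .inr (.inr (h, !b)) := Iff.rfl

theorem ofRows_lower {x y : X} : (ofRows f g).graph.Adj (.inr x) (.inr y) ↔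
    ∃ h b, g x = .inr (.inr (h, b)) ∧ g y = .inr (.inr (h, !b)) := Iff.rfl

theorem ofRows_transversal {x y : X} : (ofRows f g).graph.Adj (.inl x) (.inr y) ↔
    ∃ t, f x = .inl t ∧ g y = .inl t := Iff.rfl

theorem star_ofRows : star (ofRows f g) = ofRows g f := by
  ext (x | x) (y | y)
  · rfl
  · exact exists_congr fun t => and_comm
  · exact exists_congr fun t => and_comm
  · rfl

theorem ofRows_upper_single {x : X} :
    (∀ v, ¬ (ofRows f g).graph.Adj (.inl x) v) ↔ ∃ s, f x = .inr (.inl s) := by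
  constructor
  · intro h
    rcases e : f x with t | s | ⟨a, b⟩
    · exact absurd ⟨t, e, g.apply_symm_apply _⟩ (h (.inr (g.symm (.inl t))))
    · exact ⟨s, rfl⟩
    · exact absurd ⟨a, b, e, f.apply_symm_apply _⟩ (h (.inl (f.symm (.inr (.inr (a, !b))))))
  · rintro ⟨s, hs⟩ (y | y)
    · rintro ⟨h, b, h1, h2⟩; rw [h1] at hs; simp at hs
    · rintro ⟨t, h1, h2⟩; rw [h1] at hs; simp at hs

theorem ofRows_lower_single {x : X} :
    (∀ v, ¬ (ofRows f g).graph.Adj (.inr x) v) ↔ ∃ s, g x = .inr (.inl s) := by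
  rw [← ofRows_upper_single g f, ← star_ofRows]
  exact ⟨fun h v hv => h v.swap (by simpa [star_adj] using hv), fun h v hv => h v.swap hv⟩

theorem t_ofRows : (ofRows f g).t = #T := by
  refine (mk_congr (Equiv.ofBijective (fun t => ⟨(f.symm (.inl t), g.symm (.inl t)), t,
    f.apply_symm_apply _, g.apply_symm_apply _⟩) ⟨?_, ?_⟩)).symm
  · intro t t' h
    have h1 := congrArg (fun p => p.1.1) h
    simpa using h1
  · rintro ⟨⟨x, y⟩, t, h1, h2⟩
    refine ⟨t, Subtype.ext (Prod.ext ?_ ?_)⟩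
    · exact f.injective (by simpa using h1.symm)
    · exact g.injective (by simpa using h2.symm)

theorem s_ofRows : (ofRows f g).s = #S := by
  refine (mk_congr (Equiv.ofBijective (fun s => ⟨f.symm (.inr (.inl s)),
    (ofRows_upper_single f g).2 ⟨s, f.apply_symm_apply _⟩⟩) ⟨?_, ?_⟩)).symm
  · intro t t' h
    have h1 := congrArg (fun p => p.1) h
    simpa using h1
  · rintro ⟨x, hx⟩
    obtain ⟨s, hs⟩ := (ofRows_upper_single f g).1 hx
    exact ⟨s, Subtype.ext (f.injective (by simpa using hs.symm))⟩

theorem h_ofRows : (ofRows f g).h = #H := by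
  refine (mk_congr (Equiv.ofBijective (fun h => ⟨s(f.symm (.inr (.inr (h, true))),
    f.symm (.inr (.inr (h, false)))), h, true, f.apply_symm_apply _, f.apply_symm_apply _⟩)
    ⟨?_, ?_⟩)).symm
  · intro t t' h
    have h1 := congrArg (fun p => p.1) h
    simpa using h1
  · rintro ⟨e, he⟩
    induction e using Sym2.ind with
    | _ x y =>
      obtain ⟨h, b, h1, h2⟩ := he
      obtain rfl : x = f.symm (.inr (.inr (h, b))) := f.injective (by simpa using h1)
      obtain rfl : y = f.symm (.inr (.inr (h, !b))) := f.injective (by simpa using h2)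
      refine ⟨h, Subtype.ext ?_⟩
      cases b
      · exact Sym2.eq_swap
      · rfl

theorem sStar_ofRows : (ofRows f g).sStar = #S' := by
  rw [← s_star, star_ofRows, s_ofRows]

theorem hStar_ofRows : (ofRows f g).hStar = #H' := by
  rw [← h_star, star_ofRows, h_ofRows]

end NormalForm

/-- The labelling `eT` of the transversals is prescribed, so that the upper and the lower row can
later be given matching labels. -/
theorem exists_row (α : PartialBrauer X) {T S H : Type u} (eT : T ≃ dom α) (hS : #S = α.s)
    (hH : #H = α.h) : ∃ f : X ≃ T ⊕ S ⊕ H × Bool, (∀ x t, f x = .inl t ↔ (eT t).1 = x) ∧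
      ∀ x y, (∃ h b, f x = .inr (.inr (h, b)) ∧ f y = .inr (.inr (h, !b))) ↔
        α.graph.Adj (.inl x) (.inl y) := by
  obtain ⟨eS⟩ := Cardinal.eq.1 hS
  obtain ⟨eH⟩ := Cardinal.eq.1 hH
  have hp : ∀ e : Sym2 X, ∃ p : X × X, e = s(p.1, p.2) := fun e => by
    induction e using Sym2.ind with
    | _ x y => exact ⟨(x, y), rfl⟩
  choose p hp using hp
  let k : H × Bool → X := fun a => cond a.2 (p (eH a.1).1).1 (p (eH a.1).1).2
  have hk : ∀ a b, (eH a).1 = s(k (a, b), k (a, !b)) := by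
    rintro a (b | b)
    · exact (hp _).trans Sym2.eq_swap
    · exact hp _
  have hadj : ∀ a b, α.graph.Adj (.inl (k (a, b))) (.inl (k (a, !b))) := by
    intro a b
    have := (eH a).2
    rw [hk a b] at this
    exact this
  let φ : T ⊕ S ⊕ H × Bool → X := Sum.elim (fun t => (eT t).1) (Sum.elim (fun s => (eS s).1) k)
  have hTS : ∀ t s, (eT t).1 ≠ (eS s).1 := fun t s e => by
    obtain ⟨y, hy⟩ := (eT t).2
    rw [e] at hy
    exact (eS s).2 _ hy
  have hTk : ∀ t a, (eT t).1 ≠ k a := fun t a e => by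
    obtain ⟨y, hy⟩ := (eT t).2
    rw [e] at hy
    have := α.eq_of_adj _ _ _ hy (hadj a.1 a.2)
    simp at this
  have hSk : ∀ s a, (eS s).1 ≠ k a := fun s a e => by
    have := hadj a.1 a.2
    rw [Prod.mk.eta, ← e] at this
    exact (eS s).2 _ this
  have hkk : Function.Injective k := by
    rintro ⟨a, b⟩ ⟨a', b'⟩ e
    have h1 := hadj a b
    rw [e] at h1
    have h2 := Sum.inl_injective (α.eq_of_adj _ _ _ h1 (hadj a' b'))
    have h3 : a = a' := by
      apply eH.injective
      apply Subtype.ext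
      rw [hk a b, hk a' b', e, h2]
    subst h3
    by_cases hb : b = b'
    · rw [hb]
    · have : b' = !b := by revert hb; cases b <;> cases b' <;> decide
      rw [this] at e
      exact absurd (congrArg Sum.inl e) (hadj a b).ne
  have hφ : Function.Bijective φ := by
    constructor
    · rintro (t | s | a) (t' | s' | a') e
      · rw [eT.injective (Subtype.ext e)]
      · exact absurd e (hTS _ _)
      · exact absurd e (hTk _ _)
      · exact absurd e.symm (hTS _ _)
      · rw [eS.injective (Subtype.ext e)]
      · exact absurd e (hSk _ _)
      · exact absurd e.symm (hTk _ _)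
      · exact absurd e.symm (hSk _ _)
      · rw [hkk e]
    · intro x
      by_cases h : ∃ v, α.graph.Adj (.inl x) v
      · obtain ⟨y | y, hy⟩ := h
        · have he := hk (eH.symm ⟨s(x, y), hy⟩) true
          rw [eH.apply_symm_apply] at he
          rcases Sym2.eq_iff.1 he with ⟨h1, h2⟩ | ⟨h1, h2⟩
          · exact ⟨.inr (.inr (_, true)), h1.symm⟩
          · exact ⟨.inr (.inr (_, !true)), h1.symm⟩
        · refine ⟨.inl (eT.symm ⟨x, y, hy⟩), ?_⟩
          simp [φ]
      · refine ⟨.inr (.inl (eS.symm ⟨x, not_exists.1 h⟩)), ?_⟩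
        simp [φ]
  let F := Equiv.ofBijective φ hφ
  have hF : ∀ x c, F.symm x = c ↔ φ c = x := fun x c => by
    rw [Equiv.symm_apply_eq]
    exact eq_comm
  refine ⟨F.symm, fun x t => hF _ _, fun x y => ?_⟩
  simp only [hF]
  constructor
  · rintro ⟨a, b, rfl, rfl⟩
    exact hadj a b
  · intro h
    obtain ⟨c, rfl⟩ := hφ.2 x
    rcases c with t | s | ⟨a, b⟩
    · obtain ⟨z, hz⟩ := (eT t).2
      have := α.eq_of_adj _ _ _ h hz
      simp at this
    · exact absurd h ((eS s).2 _)
    · exact ⟨a, b, rfl, Sum.inl_injective (α.eq_of_adj _ _ _ (hadj a b) h)⟩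

theorem exists_eq_ofRows (α : PartialBrauer X) {T S H S' H' : Type u} (hT : #T = α.t)
    (hS : #S = α.s) (hH : #H = α.h) (hS' : #S' = α.sStar) (hH' : #H' = α.hStar) :
    ∃ (f : X ≃ T ⊕ S ⊕ H × Bool) (g : X ≃ T ⊕ S' ⊕ H' × Bool), α = ofRows f g := by
  rw [t_eq_mk_dom] at hT
  obtain ⟨eT⟩ := Cardinal.eq.1 hT
  have hφ : ∀ x : dom α, ∃ y : dom (star α), α.graph.Adj (.inl x.1) (.inr y.1) :=
    fun ⟨x, y, hy⟩ => ⟨⟨y, mem_dom_star.2 ⟨x, hy⟩⟩, hy⟩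
  choose φ hφ using hφ
  have hb : Function.Bijective φ := by
    constructor
    · intro x y e
      have := hφ x
      rw [e] at this
      exact Subtype.ext (lower_unique this (hφ y))
    · rintro ⟨y, hy⟩
      obtain ⟨x, hx⟩ := mem_dom_star.1 hy
      exact ⟨⟨x, y, hx⟩, Subtype.ext (upper_unique (hφ ⟨x, y, hx⟩) hx)⟩
  obtain ⟨f, hf1, hf2⟩ := exists_row α eT hS hH
  obtain ⟨g, hg1, hg2⟩ := exists_row (star α) (eT.trans (Equiv.ofBijective φ hb))
    (hS'.trans (s_star α).symm) (hH'.trans (h_star α).symm)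
  refine ⟨f, g, ?_⟩
  have hT : ∀ x y, α.graph.Adj (.inl x) (.inr y) ↔ (ofRows f g).graph.Adj (.inl x) (.inr y) := by
    intro x y
    rw [ofRows_transversal]
    simp only [hf1, hg1]
    constructor
    · intro h
      refine ⟨eT.symm ⟨x, y, h⟩, by simp, ?_⟩
      simp only [Equiv.trans_apply, Equiv.apply_symm_apply, Equiv.ofBijective_apply]
      exact upper_unique (hφ ⟨x, y, h⟩) h
    · rintro ⟨t, rfl, rfl⟩
      exact hφ _
  ext (x | x) (y | y)
  · rw [ofRows_upper, hf2]
  · exact hT x y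
  · rw [SimpleGraph.adj_comm, hT, SimpleGraph.adj_comm]
  · rw [ofRows_lower, hg2]; rfl

theorem defect_ofRows {T S H S' H' : Type u} (f : X ≃ T ⊕ S ⊕ H × Bool)
    (g : X ≃ T ⊕ S' ⊕ H' × Bool) : defect (ofRows f g) = #S + #H * 2 := by
  have : #↥(dom (ofRows f g))ᶜ = #(S ⊕ H × Bool) := by
    refine mk_congr (Equiv.symm (Equiv.ofBijective (fun c => ⟨f.symm (.inr c), ?_⟩) ⟨?_, ?_⟩))
    · rintro ⟨y, hy⟩
      rw [ofRows_transversal] at hy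
      simp at hy
    · intro c d e
      simpa using congrArg Subtype.val e
    · rintro ⟨x, hx⟩
      obtain ⟨c, rfl⟩ := f.symm.surjective x
      rcases c with t | c
      · refine absurd ⟨g.symm (.inl t), ?_⟩ hx
        rw [ofRows_transversal]
        exact ⟨t, by simp⟩
      · exact ⟨c, rfl⟩
  rw [defect, this]
  simp

theorem exists_types_eq_ofRows (α : PartialBrauer X) : ∃ (T S H S' H' : Type u)
    (f : X ≃ T ⊕ S ⊕ H × Bool) (g : X ≃ T ⊕ S' ⊕ H' × Bool), α = ofRows f g := by
  obtain ⟨f, g, h⟩ := exists_eq_ofRows α (mk_out _) (mk_out _) (mk_out _) (mk_out _) (mk_out _)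
  exact ⟨_, _, _, _, _, f, g, h⟩

theorem defect_eq (α : PartialBrauer X) : defect α = α.s + α.h * 2 := by
  obtain ⟨T, S, H, S', H', f, g, rfl⟩ := exists_types_eq_ofRows α
  rw [defect_ofRows, s_ofRows, h_ofRows]

theorem defect_star_eq (α : PartialBrauer X) : defect (star α) = α.sStar + α.hStar * 2 := by
  rw [defect_eq, s_star, h_star]

/-! ### Units, double cosets and idempotents. -/

/-- The unit with edges `{x, (π x)'}`. -/
def ofPerm (π : X ≃ X) : PartialBrauer X :=
  ofRows (T := X) (S := PEmpty) (H := PEmpty) (S' := PEmpty) (H' := PEmpty)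
    ((π.trans (Equiv.sumEmpty X _).symm)) (Equiv.sumEmpty X _).symm

theorem ofPerm_adj (π : X ≃ X) (x : X) : (ofPerm π).graph.Adj (.inl x) (.inr (π x)) :=
  ⟨π x, rfl, rfl⟩

theorem ofPerm_mul_ofRows {T S H S' H' : Type u} (π : X ≃ X) (f : X ≃ T ⊕ S ⊕ H × Bool)
    (g : X ≃ T ⊕ S' ⊕ H' × Bool) : ofPerm π * ofRows f g = ofRows (π.trans f) g := by
  apply eq_of_le_of_isolated
  · have ht : ∀ x y, (ofRows (π.trans f) g).graph.Adj (.inl x) (.inr y) →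
        (ofPerm π * ofRows f g).graph.Adj (.inl x) (.inr y) :=
      fun x y h => mul_transversal (ofPerm_adj π x) h
    rintro (x | x) (y | y) h
    · exact mul_upper_hook_of_hook (ofPerm_adj π x) h (ofPerm_adj π y)
    · exact ht x y h
    · exact (ht y x h).symm
    · exact mul_lower_hook h
  · rintro (x | x) h
    · rw [ofRows_upper_single] at h
      exact mul_upper_single_of_single (ofPerm_adj π x) ((ofRows_upper_single f g).2 h)
    · rw [ofRows_lower_single, ← ofRows_lower_single f] at h
      exact mul_lower_single h

theorem ofPerm_mul_ofPerm (π τ : X ≃ X) : ofPerm π * ofPerm τ = ofPerm (π.trans τ) :=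
  ofPerm_mul_ofRows _ _ _

theorem ofPerm_refl : ofPerm (Equiv.refl X) = 1 := by
  symm
  apply eq_of_le_of_isolated
  · rintro (x | x) (y | y) h
    · obtain ⟨h, -⟩ := h; exact h.elim
    · obtain ⟨t, h1, h2⟩ := h
      exact congrArg Sum.inr (Sum.inl_injective (h2.trans h1.symm))
    · obtain ⟨t, h1, h2⟩ := h
      exact congrArg Sum.inl (Sum.inl_injective (h1.trans h2.symm))
    · obtain ⟨h, -⟩ := h; exact h.elim
  · rintro (x | x) h
    · exact absurd (ofPerm_adj _ x) (h _)
    · exact absurd (ofPerm_adj _ x).symm (h _)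

theorem isUnit_ofPerm (π : X ≃ X) : IsUnit (ofPerm π) :=
  isUnit_iff_exists.2 ⟨ofPerm π.symm, by simp [ofPerm_mul_ofPerm, ofPerm_refl],
    by simp [ofPerm_mul_ofPerm, ofPerm_refl]⟩

/-- Equal parameters allow both graphs to be written with the same label types; permutations of the
two rows then carry one labelling to the other. -/
theorem exists_isUnit_mul_mul {α β : PartialBrauer X} (ht : α.t = β.t) (hs : α.s = β.s)
    (hh : α.h = β.h) (hs' : α.sStar = β.sStar) (hh' : α.hStar = β.hStar) :
    ∃ γ δ, IsUnit γ ∧ IsUnit δ ∧ γ * α * δ = β := by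
  obtain ⟨T, S, H, S', H', f, g, rfl⟩ := exists_types_eq_ofRows α
  rw [t_ofRows] at ht
  rw [s_ofRows] at hs
  rw [h_ofRows] at hh
  rw [sStar_ofRows] at hs'
  rw [hStar_ofRows] at hh'
  obtain ⟨f', g', rfl⟩ := exists_eq_ofRows β ht hs hh hs' hh'
  refine ⟨ofPerm (f'.trans f.symm), star (ofPerm (g'.trans g.symm)), isUnit_ofPerm _,
    isUnit_star (isUnit_ofPerm _), ?_⟩
  have h1 : (f'.trans f.symm).trans f = f' := by ext; simp
  have h2 : (g'.trans g.symm).trans g = g' := by ext; simp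
  rw [ofPerm_mul_ofRows, h1, ← star_star (ofRows _ g), ← star_mul, star_ofRows,
    ofPerm_mul_ofRows, star_ofRows, h2]

/-- `α` has `t`, `s`, `h`, `s'`, `h'` transversals, upper singletons, upper hooks, lower singletons
and lower hooks. -/
structure HasParams (α : PartialBrauer X) (t s h s' h' : Cardinal.{u}) : Prop where
  t_eq : α.t = t
  s_eq : α.s = s
  h_eq : α.h = h
  sStar_eq : α.sStar = s'
  hStar_eq : α.hStar = h'

theorem hasParams_ofRows {T S H S' H' : Type u} (f : X ≃ T ⊕ S ⊕ H × Bool)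
    (g : X ≃ T ⊕ S' ⊕ H' × Bool) : HasParams (ofRows f g) #T #S #H #S' #H' :=
  ⟨t_ofRows f g, s_ofRows f g, h_ofRows f g, sStar_ofRows f g, hStar_ofRows f g⟩

theorem exists_idempotent {t s h s' h' : Cardinal.{u}} (hX : t + (s + h * 2) = #X)
    (hd : s + h * 2 = s' + h' * 2) :
    ∃ α : PartialBrauer X, HasParams α t s h s' h' ∧ α * α = α := by
  induction t, s using Cardinal.inductionOn₂ with | _ T S
  induction h, s' using Cardinal.inductionOn₂ with | _ H S'
  induction h' using Cardinal.inductionOn with | _ H'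
  have e1 : #X = #(T ⊕ S ⊕ H × Bool) := by simp [← hX]
  have e2 : #(S ⊕ H × Bool) = #(S' ⊕ H' × Bool) := by simpa using hd
  obtain ⟨f⟩ := Cardinal.eq.1 e1
  obtain ⟨i⟩ := Cardinal.eq.1 e2
  -- The lower row keeps the transversal labels of the upper row, so every transversal is vertical;
  -- only the complement, of equal size in both rows, is relabelled.
  let g := f.trans ((Equiv.refl T).sumCongr i)
  refine ⟨ofRows f g, hasParams_ofRows _ _, ?_⟩
  have key : ∀ x y, (ofRows f g).graph.Adj (.inl x) (.inr y) → x = y := by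
    intro x y h
    obtain ⟨t, h1, h2⟩ := h
    obtain ⟨c, rfl⟩ := f.symm.surjective y
    rcases c with t' | c
    · simp [g] at h2
      subst h2
      exact f.injective (by simpa using h1)
    · simp [g] at h2
  have hT : ∀ x y, (ofRows f g).graph.Adj (.inl x) (.inr y) →
      (ofRows f g * ofRows f g).graph.Adj (.inl x) (.inr y) := by
    intro x y h
    obtain rfl := key x y h
    exact mul_transversal h h
  apply eq_of_le_of_isolated
  · rintro (x | x) (y | y) h
    · exact mul_upper_hook h
    · exact hT x y h
    · exact (hT y x h.symm).symm
    · exact mul_lower_hook h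
  · rintro (x | x) h
    · exact mul_upper_single h
    · exact mul_lower_single h

end PartialBrauer

/-! ### Products computed in blocks. -/

/-- Merging the transversals of the second kind with the rest of a row. -/
def Equiv.rowMerge (K A S H B C : Type u) :
    K ⊕ A ⊕ (B ⊕ C × Bool) ⊕ (S ⊕ H × Bool) ≃ (K ⊕ A) ⊕ (B ⊕ S) ⊕ (C ⊕ H) × Bool where
  toFun
    | .inl k => .inl (.inl k)
    | .inr (.inl a) => .inl (.inr a)
    | .inr (.inr (.inl (.inl b))) => .inr (.inl (.inl b))
    | .inr (.inr (.inl (.inr (c, e)))) => .inr (.inr (.inl c, e))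
    | .inr (.inr (.inr (.inl s))) => .inr (.inl (.inr s))
    | .inr (.inr (.inr (.inr (h, e)))) => .inr (.inr (.inr h, e))
  invFun
    | .inl (.inl k) => .inl k
    | .inl (.inr a) => .inr (.inl a)
    | .inr (.inl (.inl b)) => .inr (.inr (.inl (.inl b)))
    | .inr (.inr (.inl c, e)) => .inr (.inr (.inl (.inr (c, e))))
    | .inr (.inl (.inr s)) => .inr (.inr (.inr (.inl s)))
    | .inr (.inr (.inr h, e)) => .inr (.inr (.inr (.inr (h, e))))
  left_inv := by rintro (k | a | (b | ⟨c, e⟩) | (s | ⟨h, e⟩)) <;> rfl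
  right_inv := by rintro ((k | a) | (b | s) | ⟨c | h, e⟩) <;> rfl

/-- Moving some transversals of a row to its singletons and hooks. -/
def Equiv.rowMove (K S H A C : Type u) :
    (K ⊕ A ⊕ C × Bool) ⊕ S ⊕ H × Bool ≃ K ⊕ (S ⊕ A) ⊕ (H ⊕ C) × Bool where
  toFun
    | .inl (.inl k) => .inl k
    | .inl (.inr (.inl a)) => .inr (.inl (.inr a))
    | .inl (.inr (.inr (c, e))) => .inr (.inr (.inr c, e))
    | .inr (.inl s) => .inr (.inl (.inl s))
    | .inr (.inr (h, e)) => .inr (.inr (.inl h, e))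
  invFun
    | .inl k => .inl (.inl k)
    | .inr (.inl (.inr a)) => .inl (.inr (.inl a))
    | .inr (.inr (.inr c, e)) => .inl (.inr (.inr (c, e)))
    | .inr (.inl (.inl s)) => .inr (.inl s)
    | .inr (.inr (.inl h, e)) => .inr (.inr (h, e))
  left_inv := by rintro ((k | a | ⟨c, e⟩) | s | ⟨h, e⟩) <;> rfl
  right_inv := by rintro (k | (s | a) | ⟨h | c, e⟩) <;> rfl

/-- Replacing one summand by an equivalent one and swapping two others. -/
def Equiv.rowSwap {K A B J J' : Type u} (i : J ≃ J') : K ⊕ A ⊕ B ⊕ J ≃ K ⊕ B ⊕ A ⊕ J' where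
  toFun
    | .inl k => .inl k
    | .inr (.inl a) => .inr (.inr (.inl a))
    | .inr (.inr (.inl b)) => .inr (.inl b)
    | .inr (.inr (.inr j)) => .inr (.inr (.inr (i j)))
  invFun
    | .inl k => .inl k
    | .inr (.inl b) => .inr (.inr (.inl b))
    | .inr (.inr (.inl a)) => .inr (.inl a)
    | .inr (.inr (.inr j)) => .inr (.inr (.inr (i.symm j)))
  left_inv := by rintro (k | a | b | j) <;> simp
  right_inv := by rintro (k | a | b | j) <;> simp

namespace PartialBrauer

variable {X : Type u}

/-- The middle row has four blocks. On `K` transversals meet transversals. On `A ⊕ C × Bool`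
transversals of the left factor meet singletons and hooks of the right one, and become upper
singletons and hooks. On `B ⊕ D × Bool` the roles are exchanged. On the last block no transversal of
either factor arrives, so it leaves no trace. -/
theorem ofRows_mul_ofRows {K A C B D S₀ H₀ P₀ Q₀ S H P Q : Type u}
    (e : X ≃ (K ⊕ A ⊕ C × Bool) ⊕ S ⊕ H × Bool)
    (m : X ≃ K ⊕ (A ⊕ C × Bool) ⊕ (B ⊕ D × Bool) ⊕ (S₀ ⊕ H₀ × Bool))
    (i : S₀ ⊕ H₀ × Bool ≃ P₀ ⊕ Q₀ × Bool)
    (e' : X ≃ (K ⊕ B ⊕ D × Bool) ⊕ P ⊕ Q × Bool) :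
    ofRows e (m.trans (Equiv.rowMerge _ _ _ _ _ _)) *
        ofRows ((m.trans (Equiv.rowSwap i)).trans (Equiv.rowMerge _ _ _ _ _ _)) e' =
      ofRows (e.trans (Equiv.rowMove _ _ _ _ _)) (e'.trans (Equiv.rowMove _ _ _ _ _)) := by
  generalize hα : ofRows e (m.trans (Equiv.rowMerge _ _ _ _ _ _)) = α
  generalize hβ :
    ofRows ((m.trans (Equiv.rowSwap i)).trans (Equiv.rowMerge _ _ _ _ _ _)) e' = β
  have kα : ∀ k, α.graph.Adj (.inl (e.symm (.inl (.inl k)))) (.inr (m.symm (.inl k))) := by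
    intro k; subst hα; exact ⟨.inl k, by simp, by simp [Equiv.rowMerge]⟩
  have aα : ∀ a, α.graph.Adj (.inl (e.symm (.inl (.inr a)))) (.inr (m.symm (.inr (.inl a)))) := by
    intro a; subst hα; exact ⟨.inr a, by simp, by simp [Equiv.rowMerge]⟩
  have bα : ∀ b v, ¬ α.graph.Adj (.inr (m.symm (.inr (.inr (.inl (.inl b)))))) v := by
    intro b; subst hα
    rw [ofRows_lower_single]
    exact ⟨.inl b, by simp [Equiv.rowMerge]⟩
  have dα : ∀ d c, α.graph.Adj (.inr (m.symm (.inr (.inr (.inl (.inr (d, c)))))))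
      (.inr (m.symm (.inr (.inr (.inl (.inr (d, !c))))))) := by
    intro d c; subst hα
    exact ⟨.inl d, c, by simp [Equiv.rowMerge], by simp [Equiv.rowMerge]⟩
  have kβ : ∀ k, β.graph.Adj (.inl (m.symm (.inl k))) (.inr (e'.symm (.inl (.inl k)))) := by
    intro k; subst hβ; exact ⟨.inl k, by simp [Equiv.rowMerge, Equiv.rowSwap], by simp⟩
  have bβ : ∀ b, β.graph.Adj (.inl (m.symm (.inr (.inr (.inl b)))))
      (.inr (e'.symm (.inl (.inr b)))) := by
    intro b; subst hβ; exact ⟨.inr b, by simp [Equiv.rowMerge, Equiv.rowSwap], by simp⟩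
  have aβ : ∀ a v, ¬ β.graph.Adj (.inl (m.symm (.inr (.inl (.inl a))))) v := by
    intro b; subst hβ
    rw [ofRows_upper_single]
    exact ⟨.inl b, by simp [Equiv.rowMerge, Equiv.rowSwap]⟩
  have cβ : ∀ d c, β.graph.Adj (.inl (m.symm (.inr (.inl (.inr (d, c))))))
      (.inl (m.symm (.inr (.inl (.inr (d, !c)))))) := by
    intro d c; subst hβ
    exact ⟨.inl d, c, by simp [Equiv.rowMerge, Equiv.rowSwap],
      by simp [Equiv.rowMerge, Equiv.rowSwap]⟩
  apply eq_of_le_of_isolated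
  · have ht : ∀ x y, (ofRows (e.trans (Equiv.rowMove _ _ _ _ _))
        (e'.trans (Equiv.rowMove _ _ _ _ _))).graph.Adj (.inl x) (.inr y) →
        (α * β).graph.Adj (.inl x) (.inr y) := by
      rintro x y ⟨k, h1, h2⟩
      simp only [Equiv.trans_apply, ← Equiv.eq_symm_apply] at h1 h2
      subst h1 h2
      exact mul_transversal (kα k) (kβ k)
    rintro (x | x) (y | y) h
    · obtain ⟨k | c, d, h1, h2⟩ := h <;>
      simp only [Equiv.trans_apply, ← Equiv.eq_symm_apply] at h1 h2 <;> subst h1 h2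
      · apply mul_upper_hook
        subst hα
        exact ⟨k, d, by simp [Equiv.rowMove], by simp [Equiv.rowMove]⟩
      · exact mul_upper_hook_of_hook (aα _) (cβ _ _) (aα _)
    · exact ht x y h
    · exact (ht y x h.symm).symm
    · obtain ⟨k | c, d, h1, h2⟩ := h <;>
      simp only [Equiv.trans_apply, ← Equiv.eq_symm_apply] at h1 h2 <;> subst h1 h2
      · apply mul_lower_hook
        subst hβ
        exact ⟨k, d, by simp [Equiv.rowMove], by simp [Equiv.rowMove]⟩
      · exact mul_lower_hook_of_hook (bβ _) (dα _ _) (bβ _)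
  · rintro (x | x) h
    · rw [ofRows_upper_single] at h
      obtain ⟨s | a, h⟩ := h <;>
      simp only [Equiv.trans_apply, ← Equiv.eq_symm_apply] at h <;> subst h
      · apply mul_upper_single
        subst hα
        rw [ofRows_upper_single]
        exact ⟨s, by simp [Equiv.rowMove]⟩
      · exact mul_upper_single_of_single (aα _) (aβ _)
    · rw [ofRows_lower_single] at h
      obtain ⟨s | a, h⟩ := h <;>
      simp only [Equiv.trans_apply, ← Equiv.eq_symm_apply] at h <;> subst h
      · apply mul_lower_single
        subst hβ
        rw [ofRows_lower_single]
        exact ⟨s, by simp [Equiv.rowMove]⟩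
      · exact mul_lower_single_of_single (bβ _) (bα _)

theorem exists_hasParams_mul {k a c b d s₀ h₀ p₀ q₀ s h p q : Cardinal.{u}}
    (h1 : k + (a + c * 2) + (s + h * 2) = #X)
    (h2 : k + ((a + c * 2) + ((b + d * 2) + (s₀ + h₀ * 2))) = #X)
    (h3 : s₀ + h₀ * 2 = p₀ + q₀ * 2)
    (h4 : k + (b + d * 2) + (p + q * 2) = #X) :
    ∃ α β : PartialBrauer X, HasParams α (k + (a + c * 2)) s h (b + s₀) (d + h₀) ∧
      HasParams β (k + (b + d * 2)) (a + p₀) (c + q₀) p q ∧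
      HasParams (α * β) k (s + a) (h + c) (p + b) (q + d) := by
  induction k, a using Cardinal.inductionOn₂ with | _ K A
  induction c, b using Cardinal.inductionOn₂ with | _ C B
  induction d, s₀ using Cardinal.inductionOn₂ with | _ D S₀
  induction h₀, p₀ using Cardinal.inductionOn₂ with | _ H₀ P₀
  induction q₀, s using Cardinal.inductionOn₂ with | _ Q₀ S
  induction h, p using Cardinal.inductionOn₂ with | _ H P
  induction q using Cardinal.inductionOn with | _ Q
  have e1 : #X = #((K ⊕ A ⊕ C × Bool) ⊕ S ⊕ H × Bool) := by simp [← h1]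
  have e2 : #X = #(K ⊕ (A ⊕ C × Bool) ⊕ (B ⊕ D × Bool) ⊕ (S₀ ⊕ H₀ × Bool)) := by simp [← h2]
  have e3 : #(S₀ ⊕ H₀ × Bool) = #(P₀ ⊕ Q₀ × Bool) := by simpa using h3
  have e4 : #X = #((K ⊕ B ⊕ D × Bool) ⊕ P ⊕ Q × Bool) := by simp [← h4]
  obtain ⟨e⟩ := Cardinal.eq.1 e1
  obtain ⟨m⟩ := Cardinal.eq.1 e2
  obtain ⟨i⟩ := Cardinal.eq.1 e3
  obtain ⟨e'⟩ := Cardinal.eq.1 e4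
  refine ⟨ofRows e (m.trans (Equiv.rowMerge _ _ _ _ _ _)),
    ofRows ((m.trans (Equiv.rowSwap i)).trans (Equiv.rowMerge _ _ _ _ _ _)) e', ?_, ?_, ?_⟩
  · simpa using hasParams_ofRows e (m.trans (Equiv.rowMerge _ _ _ _ _ _))
  · simpa using
      hasParams_ofRows ((m.trans (Equiv.rowSwap i)).trans (Equiv.rowMerge _ _ _ _ _ _)) e'
  · rw [ofRows_mul_ofRows e m i e']
    simpa using hasParams_ofRows (e.trans (Equiv.rowMove _ _ _ _ _))
      (e'.trans (Equiv.rowMove _ _ _ _ _))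

end PartialBrauer

/-! ### Generating all balanced elements from extremal rows. -/

namespace PartialBrauer

variable {X : Type u}

/-- All elements with the given numbers of transversals, upper singletons, upper hooks, lower
singletons and lower hooks lie in `C`. -/
def ContainsParams (C : Subsemigroup (PartialBrauer X)) (t s h s' h' : Cardinal.{u}) : Prop :=
  ∀ α : PartialBrauer X, HasParams α t s h s' h' → α ∈ C

theorem HasParams.containsParams {C : Subsemigroup (PartialBrauer X)}
    (hC : unitSet (PartialBrauer X) ⊆ C) {α : PartialBrauer X} (hα : α ∈ C)
    {t s h s' h' : Cardinal.{u}} (hp : HasParams α t s h s' h') :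
    ContainsParams C t s h s' h' := by
  intro β hβ
  obtain ⟨γ, δ, hγ, hδ, rfl⟩ := exists_isUnit_mul_mul (hp.t_eq.trans hβ.t_eq.symm)
    (hp.s_eq.trans hβ.s_eq.symm) (hp.h_eq.trans hβ.h_eq.symm) (hp.sStar_eq.trans hβ.sStar_eq.symm)
    (hp.hStar_eq.trans hβ.hStar_eq.symm)
  exact C.mul_mem (C.mul_mem (hC hγ) hα) (hC hδ)

theorem s_le (α : PartialBrauer X) : α.s ≤ #X := mk_subtype_le _

theorem h_le (α : PartialBrauer X) : α.h ≤ #X := by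
  have h1 := defect_eq α
  have h2 := defect_le α
  rw [h1] at h2
  refine le_trans ?_ (le_trans (self_le_add_left _ _) h2)
  exact le_mul_of_one_le_right' one_le_two

theorem sStar_le (α : PartialBrauer X) : α.sStar ≤ #X := mk_subtype_le _

theorem hStar_le (α : PartialBrauer X) : α.hStar ≤ #X := by
  rw [← h_star]; exact h_le _

theorem balance {α : PartialBrauer X} (h : defect (star α) = defect α) :
    α.s + α.h * 2 = α.sStar + α.hStar * 2 := by
  rw [← defect_eq, ← h, defect_star_eq]

variable (X) in
theorem hasParams_one : HasParams (1 : PartialBrauer X) #X 0 0 0 0 := by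
  rw [← ofPerm_refl]
  simpa [ofPerm] using hasParams_ofRows (T := X) (S := PEmpty) (H := PEmpty) (S' := PEmpty) (H' := PEmpty)
    (((Equiv.refl X).trans (Equiv.sumEmpty X _).symm)) (Equiv.sumEmpty X _).symm

section Generation

variable {C : Subsemigroup (PartialBrauer X)}

theorem ContainsParams.mul (hC : unitSet (PartialBrauer X) ⊆ C)
    {k a c b d s₀ h₀ p₀ q₀ s h p q : Cardinal.{u}}
    (hα : ContainsParams C (k + (a + c * 2)) s h (b + s₀) (d + h₀))
    (hβ : ContainsParams C (k + (b + d * 2)) (a + p₀) (c + q₀) p q)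
    (h1 : k + (a + c * 2) + (s + h * 2) = #X)
    (h2 : k + ((a + c * 2) + ((b + d * 2) + (s₀ + h₀ * 2))) = #X)
    (h3 : s₀ + h₀ * 2 = p₀ + q₀ * 2)
    (h4 : k + (b + d * 2) + (p + q * 2) = #X) :
    ContainsParams C k (s + a) (h + c) (p + b) (q + d) := by
  obtain ⟨α, β, p1, p2, p3⟩ := exists_hasParams_mul h1 h2 h3 h4
  exact p3.containsParams hC (C.mul_mem (hα _ p1) (hβ _ p2))

/-- The numbers `s` and `h` of singletons and hooks occur in the upper row of parameters with full
rank that `C` contains. -/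
def UpperRow (C : Subsemigroup (PartialBrauer X)) (s h : Cardinal.{u}) : Prop :=
  s ≤ #X ∧ h ≤ #X ∧ ∃ s' h', s' ≤ #X ∧ h' ≤ #X ∧ s + h * 2 = s' + h' * 2 ∧
    ContainsParams C #X s h s' h'

/-- The numbers `s'` and `h'` of singletons and hooks occur in the lower row of parameters with
full rank that `C` contains. -/
def LowerRow (C : Subsemigroup (PartialBrauer X)) (s' h' : Cardinal.{u}) : Prop :=
  s' ≤ #X ∧ h' ≤ #X ∧ ∃ s h, s ≤ #X ∧ h ≤ #X ∧ s + h * 2 = s' + h' * 2 ∧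
    ContainsParams C #X s h s' h'

theorem containsParams_one (hC : unitSet (PartialBrauer X) ⊆ C) :
    ContainsParams C #X 0 0 0 0 :=
  (hasParams_one X).containsParams hC (hC isUnit_one)

theorem upperRow_of_mem (hC : unitSet (PartialBrauer X) ⊆ C) {α : PartialBrauer X} (hα : α ∈ C)
    (hd : defect (star α) = defect α) (ht : α.t = #X) : UpperRow C α.s α.h :=
  ⟨s_le α, h_le α, α.sStar, α.hStar, sStar_le α, hStar_le α, balance hd,
    HasParams.containsParams hC hα ⟨ht, rfl, rfl, rfl, rfl⟩⟩

theorem lowerRow_of_mem (hC : unitSet (PartialBrauer X) ⊆ C) {α : PartialBrauer X} (hα : α ∈ C)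
    (hd : defect (star α) = defect α) (ht : α.t = #X) : LowerRow C α.sStar α.hStar :=
  ⟨sStar_le α, hStar_le α, α.s, α.h, s_le α, h_le α, balance hd,
    HasParams.containsParams hC hα ⟨ht, rfl, rfl, rfl, rfl⟩⟩

theorem mul_two_lt {d e : Cardinal.{u}} (hd : ℵ₀ ≤ d) (he : e < d) : e * 2 < d :=
  mul_lt_of_lt hd he ((natCast_lt_aleph0 (n := 2)).trans_le hd)

theorem mul_two_eq {d : Cardinal.{u}} (hd : ℵ₀ ≤ d) : d * 2 = d := by
  rw [mul_two, add_eq_self hd]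

theorem balance_add {s h s' h' p q p' q' : Cardinal.{u}} (h1 : s + h * 2 = s' + h' * 2)
    (h2 : p + q * 2 = p' + q' * 2) : s + p + (h + q) * 2 = p' + s' + (q' + h') * 2 := by
  calc _ = (s + h * 2) + (p + q * 2) := by ring
    _ = _ := by rw [h1, h2]; ring

variable [Infinite X]

theorem mk_add_row {s h : Cardinal.{u}} (hs : s ≤ #X) (hh : h ≤ #X) :
    #X + (s + h * 2) = #X := by
  have hX := aleph0_le_mk X
  refine add_eq_left hX (add_le_of_le hX hs (mul_le_of_le hX hh ?_))
  exact (natCast_lt_aleph0 (n := 2)).le.trans hX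

/-- At rank `|X|`, adding blocks of size at most `|X|` changes nothing, so the size conditions hold
automatically; only the matching condition `h3` on the dead middle block remains. -/
theorem ContainsParams.mul_full (hC : unitSet (PartialBrauer X) ⊆ C)
    {a c b d s₀ h₀ p₀ q₀ s h p q : Cardinal.{u}}
    (hα : ContainsParams C #X s h (b + s₀) (d + h₀))
    (hβ : ContainsParams C #X (a + p₀) (c + q₀) p q)
    (h3 : s₀ + h₀ * 2 = p₀ + q₀ * 2) (la : a ≤ #X) (lc : c ≤ #X) (lb : b ≤ #X) (ld : d ≤ #X)
    (ls₀ : s₀ ≤ #X) (lh₀ : h₀ ≤ #X) (ls : s ≤ #X) (lh : h ≤ #X) (lp : p ≤ #X) (lq : q ≤ #X) :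
    ContainsParams C #X (s + a) (h + c) (p + b) (q + d) := by
  refine ContainsParams.mul hC (s₀ := s₀) (h₀ := h₀) (p₀ := p₀) (q₀ := q₀) ?_ ?_ ?_ ?_ h3 ?_
  · rwa [mk_add_row la lc]
  · rwa [mk_add_row lb ld]
  · rw [mk_add_row la lc, mk_add_row ls lh]
  · rw [← add_assoc, ← add_assoc, mk_add_row la lc, mk_add_row lb ld, mk_add_row ls₀ lh₀]
  · rw [mk_add_row lb ld, mk_add_row lp lq]

/-- The inner rows have equal defects, so their parts off the transversals can be placed on the same
middle points, where they disappear. This decouples upper from lower rows. -/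
theorem UpperRow.containsParams (hC : unitSet (PartialBrauer X) ⊆ C) {s h s' h' : Cardinal.{u}}
    (hu : UpperRow C s h) (hl : LowerRow C s' h') (he : s + h * 2 = s' + h' * 2) :
    ContainsParams C #X s h s' h' := by
  obtain ⟨h1, h2, s₀, h₀, h3, h4, h5, h6⟩ := hu
  obtain ⟨k1, k2, p₀, q₀, k3, k4, k5, k6⟩ := hl
  have := ContainsParams.mul_full hC (a := 0) (b := 0) (c := 0) (d := 0) (by simpa using h6)
    (by simpa using k6) (h5.symm.trans (he.trans k5.symm)) (by simp) (by simp) (by simp) (by simp)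
    h3 h4 h1 h2 k1 k2
  simpa using this

theorem add_le_mk {a b : Cardinal.{u}} (ha : a ≤ #X) (hb : b ≤ #X) : a + b ≤ #X :=
  add_le_of_le (aleph0_le_mk X) ha hb

/-- The opposite placement: singletons and hooks of each inner row meet only transversals of the
other factor, so all of them are carried to the outside. -/
theorem ContainsParams.add (hC : unitSet (PartialBrauer X) ⊆ C)
    {s h s' h' p q p' q' : Cardinal.{u}} (h1 : ContainsParams C #X s h s' h')
    (h2 : ContainsParams C #X p q p' q') (ls : s ≤ #X) (lh : h ≤ #X) (ls' : s' ≤ #X)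
    (lh' : h' ≤ #X) (lp : p ≤ #X) (lq : q ≤ #X) (lp' : p' ≤ #X) (lq' : q' ≤ #X) :
    ContainsParams C #X (s + p) (h + q) (p' + s') (q' + h') :=
  ContainsParams.mul_full hC (s₀ := 0) (h₀ := 0) (p₀ := 0) (q₀ := 0) (by simpa using h1)
    (by simpa using h2) (by simp) lp lq ls' lh' (by simp) (by simp) ls lh lp' lq'

theorem UpperRow.add (hC : unitSet (PartialBrauer X) ⊆ C) {s h p q : Cardinal.{u}}
    (hs : UpperRow C s h) (hp : UpperRow C p q) : UpperRow C (s + p) (h + q) := by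
  obtain ⟨h1, h2, s₀, h₀, h3, h4, h5, h6⟩ := hs
  obtain ⟨k1, k2, p₀, q₀, k3, k4, k5, k6⟩ := hp
  exact ⟨add_le_mk h1 k1, add_le_mk h2 k2, _, _, add_le_mk k3 h3, add_le_mk k4 h4,
    balance_add h5 k5, h6.add hC k6 h1 h2 h3 h4 k1 k2 k3 k4⟩

theorem LowerRow.add (hC : unitSet (PartialBrauer X) ⊆ C) {s h p q : Cardinal.{u}}
    (hs : LowerRow C s h) (hp : LowerRow C p q) : LowerRow C (p + s) (q + h) := by
  obtain ⟨h1, h2, s₀, h₀, h3, h4, h5, h6⟩ := hs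
  obtain ⟨k1, k2, p₀, q₀, k3, k4, k5, k6⟩ := hp
  exact ⟨add_le_mk k1 h1, add_le_mk k2 h2, _, _, add_le_mk h3 k3, add_le_mk h4 k4,
    balance_add h5 k5, h6.add hC k6 h3 h4 h1 h2 k3 k4 k1 k2⟩

/-- The `e` unwanted singletons are absorbed by a left factor with `e` upper hooks and `2e` lower
singletons. Half of the latter cover them; the other half pass to the lower row. The upper row gains
only `e` hooks, and `e + d = d`. -/
theorem UpperRow.zero_of_lt (hC : unitSet (PartialBrauer X) ⊆ C) {d e : Cardinal.{u}}
    (hd : ℵ₀ ≤ d) (he : e < d) (h1 : UpperRow C e d) (h2 : UpperRow C 0 e)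
    (h3 : LowerRow C (e * 2) 0) : UpperRow C 0 d := by
  have hγ := h2.containsParams hC h3 (by simp)
  obtain ⟨-, l2, p, q, l3, l4, h5, h6⟩ := h1
  have le := h2.2.1
  have := ContainsParams.mul_full hC (b := e) (s₀ := e) (d := 0) (h₀ := 0) (a := 0) (p₀ := e)
    (c := d) (q₀ := 0) (by simpa [mul_two] using hγ) (by simpa using h6) rfl (by simp) l2 le
    (by simp) le (by simp) (by simp) le l3 l4
  rw [add_eq_right hd he.le, add_zero, add_zero] at this
  refine ⟨by simp, l2, _, _, add_le_mk l3 le, l4, ?_, this⟩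
  rw [add_right_comm, ← h5, mul_two_eq hd, add_eq_right hd he.le, add_eq_left hd he.le, zero_add]

/-- The `2e` endpoints of the unwanted hooks are placed on the `2e` lower singletons of a left
factor that has `2e` singletons in each row; since `2e < d`, the count `d` is unchanged. -/
theorem UpperRow.of_lt_zero (hC : unitSet (PartialBrauer X) ⊆ C) {d e : Cardinal.{u}}
    (hd : ℵ₀ ≤ d) (he : e < d) (h1 : UpperRow C d e) (h2 : UpperRow C (e * 2) 0)
    (h3 : LowerRow C (e * 2) 0) : UpperRow C d 0 := by
  have hγ := h2.containsParams hC h3 rfl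
  obtain ⟨l1, l2, p, q, l3, l4, h5, h6⟩ := h1
  have le := h2.1
  have := ContainsParams.mul_full hC (b := 0) (s₀ := e * 2) (d := 0) (h₀ := 0) (a := d) (p₀ := 0)
    (c := 0) (q₀ := e) (by simpa using hγ) (by simpa using h6) (by simp) l1 (by simp) (by simp)
    (by simp) le (by simp) le (by simp) l3 l4
  rw [add_eq_right hd (mul_two_lt hd he).le, add_zero, add_zero, add_zero] at this
  refine ⟨l1, by simp, _, _, l3, l4, ?_, this⟩
  rw [← h5, zero_mul, add_zero, add_eq_left hd (mul_two_lt hd he).le]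

theorem LowerRow.zero_of_lt (hC : unitSet (PartialBrauer X) ⊆ C) {d e : Cardinal.{u}}
    (hd : ℵ₀ ≤ d) (he : e < d) (h1 : LowerRow C e d) (h2 : LowerRow C 0 e)
    (h3 : UpperRow C (e * 2) 0) : LowerRow C 0 d := by
  have hγ := h3.containsParams hC h2 (by simp)
  obtain ⟨-, l2, p, q, l3, l4, h5, h6⟩ := h1
  have le := h2.2.1
  have := ContainsParams.mul_full hC (b := 0) (s₀ := e) (d := d) (h₀ := 0) (a := e) (p₀ := e)
    (c := 0) (q₀ := 0) (by simpa using h6) (by simpa [mul_two] using hγ) rfl le (by simp) (by simp)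
    l2 le (by simp) l3 l4 (by simp) le
  rw [add_eq_right hd he.le, add_zero, add_zero] at this
  refine ⟨by simp, l2, _, _, add_le_mk l3 le, l4, ?_, this⟩
  rw [add_right_comm, h5, mul_two_eq hd, add_eq_right hd he.le, add_eq_left hd he.le, zero_add]

theorem LowerRow.of_lt_zero (hC : unitSet (PartialBrauer X) ⊆ C) {d e : Cardinal.{u}}
    (hd : ℵ₀ ≤ d) (he : e < d) (h1 : LowerRow C d e) (h2 : LowerRow C (e * 2) 0)
    (h3 : UpperRow C (e * 2) 0) : LowerRow C d 0 := by
  have hγ := h3.containsParams hC h2 rfl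
  obtain ⟨l1, l2, p, q, l3, l4, h5, h6⟩ := h1
  have le := h2.1
  have := ContainsParams.mul_full hC (b := d) (s₀ := 0) (d := 0) (h₀ := e) (a := 0) (p₀ := e * 2)
    (c := 0) (q₀ := 0) (by simpa using h6) (by simpa using hγ) (by simp) (by simp) (by simp) l1
    (by simp) (by simp) l2 l3 l4 le (by simp)
  rw [add_eq_right hd (mul_two_lt hd he).le, add_zero, add_zero, add_zero] at this
  refine ⟨l1, by simp, _, _, l3, l4, ?_, this⟩
  rw [h5, zero_mul, add_zero, add_eq_left hd (mul_two_lt hd he).le]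

/-- For every `μ` that is `1` or infinite, `A` has elements of full rank with `μ` hooks and fewer
singletons, or the other way around, in the upper and in the lower row. -/
structure HasExtremal (A : Set (PartialBrauer X)) : Prop where
  upper_h : ∀ μ, (μ = 1 ∨ ℵ₀ ≤ μ ∧ μ ≤ #X) → ∃ α ∈ A, α.t = #X ∧ α.s < μ ∧ α.h = μ
  upper_s : ∀ μ, (μ = 1 ∨ ℵ₀ ≤ μ ∧ μ ≤ #X) → ∃ α ∈ A, α.t = #X ∧ α.h < μ ∧ α.s = μ
  lower_h : ∀ μ, (μ = 1 ∨ ℵ₀ ≤ μ ∧ μ ≤ #X) → ∃ α ∈ A, α.t = #X ∧ α.sStar < μ ∧ α.hStar = μ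
  lower_s : ∀ μ, (μ = 1 ∨ ℵ₀ ≤ μ ∧ μ ≤ #X) → ∃ α ∈ A, α.t = #X ∧ α.hStar < μ ∧ α.sStar = μ

theorem HasExtremal.rows (hC : unitSet (PartialBrauer X) ⊆ C)
    (hd : ∀ α ∈ C, defect (star α) = defect α) (hE : HasExtremal (C : Set (PartialBrauer X)))
    (d : Cardinal.{u}) (hdX : d ≤ #X) :
    UpperRow C 0 d ∧ UpperRow C d 0 ∧ LowerRow C 0 d ∧ LowerRow C d 0 := by
  induction d using WellFoundedLT.induction with | _ d ih
  have key : ∀ μ, (μ = 1 ∨ ℵ₀ ≤ μ ∧ μ ≤ #X) → (∃ e < μ, UpperRow C e μ) ∧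
      (∃ e < μ, UpperRow C μ e) ∧ (∃ e < μ, LowerRow C e μ) ∧ (∃ e < μ, LowerRow C μ e) := by
    intro μ hμ
    obtain ⟨α₁, a1, b1, c1, rfl⟩ := hE.upper_h μ hμ
    obtain ⟨α₂, a2, b2, c2, d2⟩ := hE.upper_s _ hμ
    obtain ⟨α₃, a3, b3, c3, d3⟩ := hE.lower_h _ hμ
    obtain ⟨α₄, a4, b4, c4, d4⟩ := hE.lower_s _ hμ
    refine ⟨⟨_, c1, upperRow_of_mem hC a1 (hd _ a1) b1⟩, ⟨_, c2, ?_⟩, ⟨_, c3, ?_⟩, ⟨_, c4, ?_⟩⟩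
    · rw [← d2]; exact upperRow_of_mem hC a2 (hd _ a2) b2
    · rw [← d3]; exact lowerRow_of_mem hC a3 (hd _ a3) b3
    · rw [← d4]; exact lowerRow_of_mem hC a4 (hd _ a4) b4
  by_cases hinf : ℵ₀ ≤ d
  · obtain ⟨⟨e1, l1, r1⟩, ⟨e2, l2, r2⟩, ⟨e3, l3, r3⟩, ⟨e4, l4, r4⟩⟩ := key d (Or.inr ⟨hinf, hdX⟩)
    have ih' := fun e (he : e < d) => ih e he (he.le.trans hdX)
    have ih2 := fun e (he : e < d) => ih' (e * 2) (mul_two_lt hinf he)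
    exact ⟨r1.zero_of_lt hC hinf l1 (ih' _ l1).1 (ih2 _ l1).2.2.2,
      r2.of_lt_zero hC hinf l2 (ih2 _ l2).2.1 (ih2 _ l2).2.2.2,
      r3.zero_of_lt hC hinf l3 (ih' _ l3).2.2.1 (ih2 _ l3).2.1,
      r4.of_lt_zero hC hinf l4 (ih2 _ l4).2.2.2 (ih2 _ l4).2.1⟩
  -- For finite `d` only level `1` is needed: there `e < 1` means `e = 0`, and the resulting rows
  -- are added `d` times to the rows of the identity.
  · obtain ⟨⟨e1, l1, r1⟩, ⟨e2, l2, r2⟩, ⟨e3, l3, r3⟩, ⟨e4, l4, r4⟩⟩ := key 1 (Or.inl rfl)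
    rw [Cardinal.lt_one_iff] at l1 l2 l3 l4
    subst l1 l2 l3 l4
    obtain ⟨n, rfl⟩ := lt_aleph0.1 (not_le.1 hinf)
    clear ih hinf hdX
    induction n with
    | zero =>
      have hu : UpperRow C 0 0 := ⟨by simp, by simp, 0, 0, by simp, by simp, rfl,
        containsParams_one hC⟩
      have hl : LowerRow C 0 0 := ⟨by simp, by simp, 0, 0, by simp, by simp, rfl,
        containsParams_one hC⟩
      simpa using ⟨hu, hl⟩
    | succ n ih =>
      obtain ⟨i1, i2, i3, i4⟩ := ih
      have := i1.add hC r1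
      have := i2.add hC r2
      have := r3.add hC i3
      have := r4.add hC i4
      push_cast
      simp_all

/-- Full rank follows by joining rows. An element of smaller rank has defect `|X|`, and is a product
of two elements of full rank that destroy `|X|` of each other's transversals. -/
theorem HasExtremal.mem (hC : unitSet (PartialBrauer X) ⊆ C)
    (hd : ∀ α ∈ C, defect (star α) = defect α) (hE : HasExtremal (C : Set (PartialBrauer X)))
    {α : PartialBrauer X} (hα : defect (star α) = defect α) : α ∈ C := by
  have hX := aleph0_le_mk X
  have hU : ∀ s h, s ≤ #X → h ≤ #X → UpperRow C s h := fun s h ls lh => by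
    simpa using (hE.rows hC hd s ls).2.1.add hC (hE.rows hC hd h lh).1
  have hL : ∀ s h, s ≤ #X → h ≤ #X → LowerRow C s h := fun s h ls lh => by
    simpa using (hE.rows hC hd s ls).2.2.2.add hC (hE.rows hC hd h lh).2.2.1
  have hb := balance hα
  rcases (t_le α).eq_or_lt with ht | ht
  · exact (hU _ _ (s_le α) (h_le α)).containsParams hC (hL _ _ (sStar_le α) (hStar_le α)) hb α
      ⟨ht, rfl, rfl, rfl, rfl⟩
  · have hdef : defect α = #X := by
      refine le_antisymm (defect_le α) (not_lt.1 fun h => ?_)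
      exact (add_lt_of_lt hX ht h).ne (mk_compl_dom α)
    rw [defect_eq] at hdef
    -- One of `s`, `h` equals `|X|`, so `|X|` further singletons or hooks of that kind can be
    -- created without changing the parameters.
    have hmax : ∀ s h : Cardinal.{u}, s ≤ #X → h ≤ #X → s + h * 2 = #X →
        ∃ a c : Cardinal.{u}, a ≤ #X ∧ c ≤ #X ∧ a + c * 2 = #X ∧ s + a = s ∧ h + c = h := by
      intro s h ls lh e
      rcases ls.eq_or_lt with rfl | hs
      · exact ⟨#X, 0, le_rfl, by simp, by simp, add_eq_self hX, by simp⟩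
      · rcases lh.eq_or_lt with rfl | hh
        · exact ⟨0, #X, by simp, le_rfl, by simp [mul_two_eq hX], by simp, add_eq_self hX⟩
        · exact absurd e (add_lt_of_lt hX hs (mul_two_lt hX hh)).ne
    obtain ⟨a, c, la, lc, hac, sa, hc⟩ := hmax _ _ (s_le α) (h_le α) hdef
    obtain ⟨b, d, lb, ld, hbd, sb, hd'⟩ := hmax _ _ (sStar_le α) (hStar_le α) (hb ▸ hdef)
    have tX : α.t + #X = #X := add_eq_right hX (t_le α)
    have XX : #X + #X = #X := add_eq_self hX
    have := ContainsParams.mul hC (k := α.t) (a := a) (c := c) (b := b) (d := d) (s₀ := 0)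
      (h₀ := 0) (p₀ := 0) (q₀ := 0) (s := α.s) (h := α.h) (p := α.sStar) (q := α.hStar)
      (by
        rw [hac, tX, add_zero, add_zero]
        exact (hU _ _ (s_le α) (h_le α)).containsParams hC (hL _ _ lb ld) (hdef.trans hbd.symm))
      (by
        rw [hbd, tX, add_zero, add_zero]
        exact (hU _ _ la lc).containsParams hC (hL _ _ (sStar_le α) (hStar_le α))
          (hac.trans (hb ▸ hdef).symm))
      (by rw [hac, tX, hdef, XX]) (by simp [hac, hbd, tX, XX]) rfl
      (by rw [hbd, tX, ← hb, hdef, XX])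
    rw [sa, hc, sb, hd'] at this
    exact this α ⟨rfl, rfl, rfl, rfl, rfl⟩

end Generation

end PartialBrauer

/-! ### The generated submonoid and what every generating set must contain. -/

namespace PartialBrauer

variable {X : Type u}

theorem mem_idempotentUnitGenerated {α : PartialBrauer X} :
    α ∈ idempotentUnitGenerated (PartialBrauer X) ↔ defect (star α) = defect α := by
  constructor
  · intro h
    induction h using Subsemigroup.closure_induction with
    | mem x hx =>
      rcases hx with hx | hx
      · exact defect_star_of_idempotent hx
      · rw [defect_of_isUnit hx, defect_of_isUnit (isUnit_star hx)]
    | mul x y _ _ hx hy => exact defect_star_mul hx hy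
  · intro h
    obtain ⟨ε, hp, hε⟩ := exists_idempotent (X := X) (by rw [← defect_eq, mk_compl_dom])
      (balance h)
    obtain ⟨γ, δ, hγ, hδ, rfl⟩ := exists_isUnit_mul_mul hp.t_eq hp.s_eq hp.h_eq hp.sStar_eq
      hp.hStar_eq
    exact mul_mem (mul_mem (Subsemigroup.subset_closure (Or.inr hγ))
      (Subsemigroup.subset_closure (Or.inl hε))) (Subsemigroup.subset_closure (Or.inr hδ))

theorem unitSet_subset : unitSet (PartialBrauer X) ⊆ idempotentUnitGenerated (PartialBrauer X) :=
  fun _ h => Subsemigroup.subset_closure (Or.inr h)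

theorem add_lt_of_one_or_infinite {μ a b : Cardinal.{u}} (hμ : μ = 1 ∨ ℵ₀ ≤ μ) (ha : a < μ)
    (hb : b < μ) : a + b < μ := by
  rcases hμ with rfl | hμ
  · rw [Cardinal.lt_one_iff] at *
    simp [ha, hb]
  · exact add_lt_of_lt hμ ha hb

theorem add_eq_of_one_or_infinite {μ a : Cardinal.{u}} (hμ : μ = 1 ∨ ℵ₀ ≤ μ) (ha : a < μ) :
    μ + a = μ := by
  rcases hμ with rfl | hμ
  · rw [Cardinal.lt_one_iff] at ha
    simp [ha]
  · exact add_eq_left hμ ha.le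

/-- In a word whose value has defect at least `μ`, take the first factor of defect at least `μ`. The
prefix before it has defect below `μ` and can hide only `κ < μ` of its upper singletons and hooks;
all others persist in the value. -/
theorem exists_of_mem_closure {U : Set (PartialBrauer X)}
    (hU : U ⊆ idempotentUnitGenerated (PartialBrauer X)) {μ : Cardinal.{u}}
    (hμ : μ = 1 ∨ ℵ₀ ≤ μ) {x : PartialBrauer X}
    (hx : x ∈ Subsemigroup.closure (unitSet (PartialBrauer X) ∪ U)) :
    defect x < μ ∨ ∃ α ∈ U, μ ≤ defect α ∧ x.t ≤ α.t ∧
      ∃ κ < μ, α.s ≤ x.s + κ ∧ α.h ≤ x.h + κ := by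
  have h0 : 0 < μ := by
    rcases hμ with rfl | hμ
    · exact zero_lt_one
    · exact aleph0_pos.trans_le hμ
  induction hx using Subsemigroup.closure_induction with
  | mem x hx =>
    rcases hx with hx | hx
    · exact Or.inl (by rwa [defect_of_isUnit hx])
    · rcases lt_or_ge (defect x) μ with h | h
      · exact Or.inl h
      · exact Or.inr ⟨x, hx, h, le_rfl, 0, h0, by simp, by simp⟩
  | mul x y hx _ ihx ihy =>
    rcases ihx with ihx | ⟨α, hα, h1, h2, κ, h3, h4, h5⟩
    · rcases ihy with ihy | ⟨α, hα, h1, h2, κ, h3, h4, h5⟩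
      · exact Or.inl ((defect_mul_le x y).trans_lt (add_lt_of_one_or_infinite hμ ihx ihy))
      -- The loss caused by `x` is its lower defect; balance turns this into the upper defect, which
      -- is below `μ`.
      · have hxF : x ∈ idempotentUnitGenerated (PartialBrauer X) :=
          (Subsemigroup.closure_le.2 (Set.union_subset unitSet_subset hU)) hx
        refine Or.inr ⟨α, hα, h1, (t_mul_le_right x y).trans h2, defect x + κ,
          add_lt_of_one_or_infinite hμ ihx h3, ?_, ?_⟩
        · rw [← add_assoc, ← mem_idempotentUnitGenerated.1 hxF]
          exact h4.trans (add_le_add_left (s_le_mul_add x y) κ)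
        · rw [← add_assoc, ← mem_idempotentUnitGenerated.1 hxF]
          exact h5.trans (add_le_add_left (h_le_mul_add x y) κ)
    · exact Or.inr ⟨α, hα, h1, (t_mul_le_left x y).trans h2, κ, h3,
        h4.trans (add_le_add_left (s_le_mul x y) κ),
        h5.trans (add_le_add_left (h_le_mul x y) κ)⟩

theorem star_mem_closure {U : Set (PartialBrauer X)} {x : PartialBrauer X}
    (hx : x ∈ Subsemigroup.closure (unitSet (PartialBrauer X) ∪ U)) :
    star x ∈ Subsemigroup.closure (unitSet (PartialBrauer X) ∪ star '' U) := by
  induction hx using Subsemigroup.closure_induction with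
  | mem x hx =>
    refine Subsemigroup.subset_closure ?_
    rcases hx with hx | hx
    · exact Or.inl (isUnit_star hx)
    · exact Or.inr ⟨x, hx, rfl⟩
  | mul x y _ _ hx hy =>
    rw [star_mul]
    exact mul_mem hy hx

theorem star_mem {x : PartialBrauer X} (hx : x ∈ idempotentUnitGenerated (PartialBrauer X)) :
    star x ∈ idempotentUnitGenerated (PartialBrauer X) := by
  rw [mem_idempotentUnitGenerated] at *
  rw [star_star, hx]

/-! ### Levels, the relative rank and the minimal generating sets. -/

variable (X) in
/-- The cardinals that are `1` or infinite and at most `#X`. -/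
abbrev Level : Type (u + 1) := {μ : Cardinal.{u} // μ = 1 ∨ (ℵ₀ ≤ μ ∧ μ ≤ #X)}

theorem mk_level_sum : #(Level X ⊕ Level X) = 2 + 2 * infiniteCardinalsLE X := by
  have : #(Level X) = 1 + infiniteCardinalsLE X := by
    have h := mk_union_of_disjoint (S := {(1 : Cardinal.{u})})
      (T := {μ : Cardinal.{u} | ℵ₀ ≤ μ ∧ μ ≤ #X}) (by
        rw [Set.disjoint_singleton_left]
        exact fun h => h.1.not_gt one_lt_aleph0)
    rw [mk_singleton] at h
    exact h
  rw [mk_sum, lift_id, this, ← mul_two]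
  ring

/-- The larger of `s` and `h` reveals both the kind of witness and its level, so the upper witnesses
are pairwise distinct. -/
theorem HasExtremal.exists_injective {U : Set (PartialBrauer X)} (hE : HasExtremal U) :
    ∃ f : Level X ⊕ Level X → U, Function.Injective f ∧
      (∀ μ, (f (.inl μ)).1.t = #X ∧ (f (.inl μ)).1.s < μ ∧ (f (.inl μ)).1.h = μ) ∧
      ∀ μ, (f (.inr μ)).1.t = #X ∧ (f (.inr μ)).1.h < μ ∧ (f (.inr μ)).1.s = μ := by
  choose α hα h1 using fun μ : Level X => hE.upper_h μ.1 μ.2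
  choose β hβ h2 using fun μ : Level X => hE.upper_s μ.1 μ.2
  have key : ∀ μ ν, α μ ≠ β ν := fun μ ν e => by
    have h3 := (h1 μ).2
    have h4 := (h2 ν).2
    rw [← e] at h4
    exact lt_asymm (h4.2 ▸ h3.1) (h3.2 ▸ h4.1)
  refine ⟨Sum.elim (fun μ => ⟨α μ, hα μ⟩) (fun μ => ⟨β μ, hβ μ⟩), ?_, h1, h2⟩
  rintro (μ | μ) (ν | ν) e
  · have e' : α μ = α ν := congrArg Subtype.val e
    have : μ = ν := Subtype.ext ((h1 μ).2.2.symm.trans (e' ▸ (h1 ν).2.2))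
    rw [this]
  · exact absurd (congrArg Subtype.val e) (key μ ν)
  · exact absurd (congrArg Subtype.val e).symm (key ν μ)
  · have e' : β μ = β ν := congrArg Subtype.val e
    have : μ = ν := Subtype.ext ((h2 μ).2.2.symm.trans (e' ▸ (h2 ν).2.2))
    rw [this]

theorem IsStandardFamily.hasExtremal {Ω : Set (PartialBrauer X)} (h : IsStandardFamily Ω) :
    HasExtremal Ω := by
  obtain ⟨α, β, rfl, -, h⟩ := h
  constructor <;> intro μ hμ <;> obtain ⟨h1, h2, h3, h4, h5, h6, h7⟩ := h ⟨μ, hμ⟩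
  · exact ⟨_, Or.inl ⟨_, rfl⟩, h1, h3, h4⟩
  · exact ⟨_, Or.inr ⟨_, rfl⟩, h2, h5, h6⟩
  · rcases h7 with ⟨k1, k2, k3, k4⟩ | ⟨k1, k2, k3, k4⟩
    · exact ⟨_, Or.inl ⟨_, rfl⟩, h1, k1, k2⟩
    · exact ⟨_, Or.inr ⟨_, rfl⟩, h2, k3, k4⟩
  · rcases h7 with ⟨k1, k2, k3, k4⟩ | ⟨k1, k2, k3, k4⟩
    · exact ⟨_, Or.inr ⟨_, rfl⟩, h2, k3, k4⟩
    · exact ⟨_, Or.inl ⟨_, rfl⟩, h1, k1, k2⟩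

/-- The defect of an extremal row determines its level: it is finite at level `1` and equal to `μ`
at an infinite level `μ`. -/
theorem eq_of_row_eq {μ ν a b p q : Cardinal.{u}} (hμ : μ = 1 ∨ ℵ₀ ≤ μ) (hν : ν = 1 ∨ ℵ₀ ≤ ν)
    (ha : a < μ) (hb : b < ν) (hp : p = a + μ * 2 ∨ p = μ + a * 2)
    (hq : q = b + ν * 2 ∨ q = ν + b * 2) (h : p = q) : μ = ν := by
  have key : ∀ {μ a p : Cardinal.{u}}, (μ = 1 ∨ ℵ₀ ≤ μ) → a < μ →
      (p = a + μ * 2 ∨ p = μ + a * 2) → (μ = 1 ∧ p < ℵ₀) ∨ (ℵ₀ ≤ μ ∧ p = μ) := by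
    rintro μ a p (rfl | hμ) ha hp
    · rw [Cardinal.lt_one_iff] at ha
      subst ha
      refine Or.inl ⟨rfl, ?_⟩
      rcases hp with rfl | rfl
      · simp
      · simp
    · refine Or.inr ⟨hμ, ?_⟩
      rcases hp with rfl | rfl
      · rw [mul_two_eq hμ, add_eq_right hμ ha.le]
      · exact add_eq_left hμ (mul_two_lt hμ ha).le
  rcases key hμ ha hp with ⟨rfl, h1⟩ | ⟨h1, rfl⟩ <;>
  rcases key hν hb hq with ⟨rfl, h2⟩ | ⟨h2, rfl⟩
  · rfl
  · exact absurd h2 (h ▸ h1).not_ge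
  · exact absurd h1 (h ▸ h2).not_ge
  · exact h

variable [Infinite X]

theorem le_mk_of_one_or_infinite {μ : Cardinal.{u}} (hμ : μ = 1 ∨ ℵ₀ ≤ μ ∧ μ ≤ #X) :
    μ ≤ #X := by
  rcases hμ with rfl | hμ
  · exact one_le_aleph0.trans (aleph0_le_mk X)
  · exact hμ.2

/-- `exists_of_mem_closure` is applied to an idempotent of full rank with only hooks, or only
singletons, `μ` of them in each row. The parameter that vanishes there is below `μ` in the generator
found; the other is at most `μ`, and being smaller would push the defect below `μ`. -/
theorem exists_upper {U : Set (PartialBrauer X)}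
    (hU : U ⊆ idempotentUnitGenerated (PartialBrauer X))
    (hgen : idempotentUnitGenerated (PartialBrauer X) ≤
      Subsemigroup.closure (unitSet (PartialBrauer X) ∪ U))
    {μ : Cardinal.{u}} (hμ : μ = 1 ∨ ℵ₀ ≤ μ ∧ μ ≤ #X) :
    (∃ α ∈ U, α.t = #X ∧ α.s < μ ∧ α.h = μ) ∧ (∃ α ∈ U, α.t = #X ∧ α.h < μ ∧ α.s = μ) := by
  have hμX := le_mk_of_one_or_infinite hμ
  have hμ' : μ = 1 ∨ ℵ₀ ≤ μ := hμ.imp_right And.left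
  constructor
  · obtain ⟨δ, hp, hδ⟩ := exists_idempotent (X := X) (t := #X) (s := 0) (h := μ) (s' := 0)
      (h' := μ) (mk_add_row (by simp) hμX) rfl
    have hm := hgen (Subsemigroup.subset_closure (Or.inl hδ))
    rcases exists_of_mem_closure hU hμ' hm with h | ⟨α, hα, h1, h2, κ, h3, h4, h5⟩
    · rw [defect_eq, hp.s_eq, hp.h_eq, zero_add, mul_two] at h
      exact absurd (self_le_add_right μ μ) h.not_ge
    · rw [hp.t_eq] at h2
      rw [hp.s_eq, zero_add] at h4
      rw [hp.h_eq, add_eq_of_one_or_infinite hμ' h3] at h5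
      have hs := h4.trans_lt h3
      refine ⟨α, hα, le_antisymm (t_le α) h2, hs, h5.eq_of_not_lt fun h => h1.not_gt ?_⟩
      rw [defect_eq, mul_two]
      exact add_lt_of_one_or_infinite hμ' hs (add_lt_of_one_or_infinite hμ' h h)
  · obtain ⟨δ, hp, hδ⟩ := exists_idempotent (X := X) (t := #X) (s := μ) (h := 0) (s' := μ)
      (h' := 0) (mk_add_row hμX (by simp)) rfl
    have hm := hgen (Subsemigroup.subset_closure (Or.inl hδ))
    rcases exists_of_mem_closure hU hμ' hm with h | ⟨α, hα, h1, h2, κ, h3, h4, h5⟩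
    · rw [defect_eq, hp.s_eq, hp.h_eq, zero_mul, add_zero] at h
      exact absurd h (lt_irrefl _)
    · rw [hp.t_eq] at h2
      rw [hp.h_eq, zero_add] at h5
      rw [hp.s_eq, add_eq_of_one_or_infinite hμ' h3] at h4
      have hs := h5.trans_lt h3
      refine ⟨α, hα, le_antisymm (t_le α) h2, hs, h4.eq_of_not_lt fun h => h1.not_gt ?_⟩
      rw [defect_eq, mul_two]
      exact add_lt_of_one_or_infinite hμ' h (add_lt_of_one_or_infinite hμ' hs hs)

theorem hasExtremal_of_closure_eq {U : Set (PartialBrauer X)}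
    (hU : U ⊆ idempotentUnitGenerated (PartialBrauer X))
    (hgen : Subsemigroup.closure (unitSet (PartialBrauer X) ∪ U) =
      idempotentUnitGenerated (PartialBrauer X)) : HasExtremal U := by
  have hU' : star '' U ⊆ idempotentUnitGenerated (PartialBrauer X) := by
    rintro _ ⟨x, hx, rfl⟩
    exact star_mem (hU hx)
  have hgen' : idempotentUnitGenerated (PartialBrauer X) ≤
      Subsemigroup.closure (unitSet (PartialBrauer X) ∪ star '' U) := fun x hx => by
    rw [← star_star x]
    exact star_mem_closure (hgen ▸ star_mem hx)
  refine ⟨fun μ hμ => (exists_upper hU hgen.ge hμ).1, fun μ hμ => (exists_upper hU hgen.ge hμ).2,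
    fun μ hμ => ?_, fun μ hμ => ?_⟩
  · obtain ⟨_, ⟨α, hα, rfl⟩, h1, h2, h3⟩ := (exists_upper hU' hgen' hμ).1
    rw [t_star] at h1
    rw [s_star] at h2
    rw [h_star] at h3
    exact ⟨α, hα, h1, h2, h3⟩
  · obtain ⟨_, ⟨α, hα, rfl⟩, h1, h2, h3⟩ := (exists_upper hU' hgen' hμ).2
    rw [t_star] at h1
    rw [h_star] at h2
    rw [s_star] at h3
    exact ⟨α, hα, h1, h2, h3⟩

theorem HasExtremal.closure_eq {U : Set (PartialBrauer X)}
    (hU : U ⊆ idempotentUnitGenerated (PartialBrauer X)) (hE : HasExtremal U) :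
    Subsemigroup.closure (unitSet (PartialBrauer X) ∪ U) =
      idempotentUnitGenerated (PartialBrauer X) := by
  have hle : Subsemigroup.closure (unitSet (PartialBrauer X) ∪ U) ≤
      idempotentUnitGenerated (PartialBrauer X) :=
    Subsemigroup.closure_le.2 (Set.union_subset unitSet_subset hU)
  have hUC : U ⊆ Subsemigroup.closure (unitSet (PartialBrauer X) ∪ U) :=
    fun x hx => Subsemigroup.subset_closure (Or.inr hx)
  have hE' : HasExtremal (Subsemigroup.closure (unitSet (PartialBrauer X) ∪ U) :
      Set (PartialBrauer X)) := by
    constructor <;> intro μ hμ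
    · exact (hE.upper_h μ hμ).imp fun _ h => ⟨hUC h.1, h.2⟩
    · exact (hE.upper_s μ hμ).imp fun _ h => ⟨hUC h.1, h.2⟩
    · exact (hE.lower_h μ hμ).imp fun _ h => ⟨hUC h.1, h.2⟩
    · exact (hE.lower_s μ hμ).imp fun _ h => ⟨hUC h.1, h.2⟩
  refine le_antisymm hle fun x hx => ?_
  exact hE'.mem (fun y hy => Subsemigroup.subset_closure (Or.inl hy))
    (fun y hy => mem_idempotentUnitGenerated.1 (hle hy)) (mem_idempotentUnitGenerated.1 hx)

variable (X) in
-- An idempotent with the same parameters in both rows is an upper and a lower witness at once, so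
-- two elements per level satisfy all four conditions.
theorem exists_hasExtremal : ∃ U : Set (PartialBrauer X),
    U ⊆ idempotentUnitGenerated (PartialBrauer X) ∧ HasExtremal U ∧
      Cardinal.lift.{u + 1} #U ≤ #(Level X ⊕ Level X) := by
  choose α hα hα' using fun μ : Level X => exists_idempotent (X := X) (t := #X) (s := 0)
    (h := μ.1) (s' := 0) (h' := μ.1) (mk_add_row (by simp) (le_mk_of_one_or_infinite μ.2)) rfl
  choose β hβ hβ' using fun μ : Level X => exists_idempotent (X := X) (t := #X) (s := μ.1)
    (h := 0) (s' := μ.1) (h' := 0) (mk_add_row (le_mk_of_one_or_infinite μ.2) (by simp)) rfl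
  have hpos : ∀ μ : Cardinal.{u}, (μ = 1 ∨ ℵ₀ ≤ μ ∧ μ ≤ #X) → 0 < μ := by
    rintro μ (rfl | hμ)
    · exact zero_lt_one
    · exact aleph0_pos.trans_le hμ.1
  refine ⟨Set.range (Sum.elim α β), ?_, ?_, ?_⟩
  · rintro _ ⟨μ | μ, rfl⟩
    · exact Subsemigroup.subset_closure (Or.inl (hα' μ))
    · exact Subsemigroup.subset_closure (Or.inl (hβ' μ))
  · constructor <;> intro μ hμ <;> have h1 := hα ⟨μ, hμ⟩ <;> have h2 := hβ ⟨μ, hμ⟩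
    · exact ⟨_, ⟨.inl ⟨μ, hμ⟩, rfl⟩, h1.t_eq, h1.s_eq ▸ hpos μ hμ, h1.h_eq⟩
    · exact ⟨_, ⟨.inr ⟨μ, hμ⟩, rfl⟩, h2.t_eq, h2.h_eq ▸ hpos μ hμ, h2.s_eq⟩
    · exact ⟨_, ⟨.inl ⟨μ, hμ⟩, rfl⟩, h1.t_eq, h1.sStar_eq ▸ hpos μ hμ, h1.hStar_eq⟩
    · exact ⟨_, ⟨.inr ⟨μ, hμ⟩, rfl⟩, h2.t_eq, h2.hStar_eq ▸ hpos μ hμ, h2.sStar_eq⟩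
  · have := mk_range_le_lift (f := Sum.elim α β)
    rwa [lift_id'.{u, u + 1}] at this

variable (X) in
theorem lift_relativeRank :
    Cardinal.lift.{u + 1} (relativeRank (idempotentUnitGenerated (PartialBrauer X))
      (unitSet (PartialBrauer X))) = #(Level X ⊕ Level X) := by
  obtain ⟨U, hU, hE, hc⟩ := exists_hasExtremal X
  apply le_antisymm
  · refine le_trans (Cardinal.lift_le.2 ?_) hc
    exact csInf_le' ⟨U, hU, hE.closure_eq hU, rfl⟩
  · obtain ⟨V, hV, hgen, e⟩ := csInf_mem (s := {c | ∃ U : Set (PartialBrauer X),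
        U ⊆ idempotentUnitGenerated (PartialBrauer X) ∧
        Subsemigroup.closure (unitSet (PartialBrauer X) ∪ U) =
          idempotentUnitGenerated (PartialBrauer X) ∧ #U = c})
      ⟨_, U, hU, hE.closure_eq hU, rfl⟩
    obtain ⟨f, hf, -⟩ := (hasExtremal_of_closure_eq hV hgen).exists_injective
    rw [relativeRank, ← e]
    have := mk_le_of_injective (hf := (Equiv.ulift.{u + 1}.symm.injective.comp hf))
    simpa using this

theorem isStandardFamily_of_closure_eq (hρ : infiniteCardinalsLE X < ℵ₀)
    {Ω : Set (PartialBrauer X)} (hΩ : Ω ⊆ idempotentUnitGenerated (PartialBrauer X))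
    (hc : Cardinal.lift.{u + 1} #Ω = 2 + 2 * infiniteCardinalsLE X)
    (hgen : Subsemigroup.closure (unitSet (PartialBrauer X) ∪ Ω) =
      idempotentUnitGenerated (PartialBrauer X)) : IsStandardFamily Ω := by
  have hE := hasExtremal_of_closure_eq hΩ hgen
  obtain ⟨f, hf, hα, hβ⟩ := hE.exists_injective
  have hlt : Cardinal.lift.{u + 1} #Ω < ℵ₀ := by
    rw [hc]
    have h2 : (2 : Cardinal) < ℵ₀ := natCast_lt_aleph0 (n := 2)
    exact add_lt_aleph0 h2 (mul_lt_aleph0 h2 hρ)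
  have hfin : Finite Ω := by
    rw [← lift_aleph0.{u + 1, u}, lift_lt] at hlt
    exact lt_aleph0_iff_finite.1 hlt
  have hcard : Nat.card Ω ≤ Nat.card (Level X ⊕ Level X) := by
    rw [Nat.card, Nat.card, mk_level_sum, ← hc, toNat_lift]
  -- An injection between finite sets of the same size is onto: `Ω` consists of the chosen upper
  -- witnesses and nothing else.
  have hsurj := (hf.bijective_of_nat_card_le hcard).2
  have hlev : ∀ μ : Level X, μ.1 = 1 ∨ ℵ₀ ≤ μ.1 := fun μ => μ.2.imp_right And.left
  have hbal : ∀ e : Ω, e.1.s + e.1.h * 2 = e.1.sStar + e.1.hStar * 2 :=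
    fun e => balance (mem_idempotentUnitGenerated.1 (hΩ e.2))
  -- A lower witness of level `μ` is an upper witness of some level `ν`, and balance of the two
  -- defects gives `ν = μ`.
  have hlow : ∀ (μ : Level X) (e : Ω), (e.1.sStar < μ ∧ e.1.hStar = μ) ∨
      (e.1.hStar < μ ∧ e.1.sStar = μ) → e = f (.inl μ) ∨ e = f (.inr μ) := by
    intro μ e he
    have hp : ∃ a < μ.1, e.1.sStar + e.1.hStar * 2 = a + μ.1 * 2 ∨
        e.1.sStar + e.1.hStar * 2 = μ.1 + a * 2 := by
      rcases he with ⟨h1, h2⟩ | ⟨h1, h2⟩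
      · exact ⟨_, h1, Or.inl (by rw [h2])⟩
      · exact ⟨_, h1, Or.inr (by rw [h2])⟩
    obtain ⟨a, ha, hp⟩ := hp
    obtain ⟨ν | ν, rfl⟩ := hsurj e
    · have := eq_of_row_eq (hlev ν) (hlev μ) (hα ν).2.1 ha (Or.inl (by rw [(hα ν).2.2])) hp
        (hbal _)
      exact Or.inl (by rw [Subtype.ext this])
    · have := eq_of_row_eq (hlev ν) (hlev μ) (hβ ν).2.1 ha (Or.inr (by rw [(hβ ν).2.2])) hp
        (hbal _)
      exact Or.inr (by rw [Subtype.ext this])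
  refine ⟨fun μ => (f (.inl μ)).1, fun μ => (f (.inr μ)).1, ?_, hΩ, fun μ => ?_⟩
  · ext x
    constructor
    · intro hx
      obtain ⟨μ | μ, e⟩ := hsurj ⟨x, hx⟩
      · exact Or.inl ⟨μ, congrArg Subtype.val e⟩
      · exact Or.inr ⟨μ, congrArg Subtype.val e⟩
    · rintro (⟨μ, rfl⟩ | ⟨μ, rfl⟩) <;> exact Subtype.property _
  · refine ⟨(hα μ).1, (hβ μ).1, (hα μ).2.1, (hα μ).2.2, (hβ μ).2.1, (hβ μ).2.2, ?_⟩
    obtain ⟨e, he, -, h1, h2⟩ := hE.lower_h μ.1 μ.2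
    obtain ⟨e', he', -, h1', h2'⟩ := hE.lower_s μ.1 μ.2
    -- One element cannot have both `hStar = μ` and `hStar < μ`, so the two lower witnesses are the
    -- two upper ones, in one order or the other.
    rcases hlow μ ⟨e, he⟩ (Or.inl ⟨h1, h2⟩) with k | k <;>
    rcases hlow μ ⟨e', he'⟩ (Or.inr ⟨h1', h2'⟩) with k' | k' <;>
    have k1 := congrArg Subtype.val k <;> have k1' := congrArg Subtype.val k' <;>
    dsimp only at k1 k1' <;> subst k1 k1'
    · exact absurd h2 h1'.ne
    · exact Or.inl ⟨h1, h2, h1', h2'⟩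
    · exact Or.inr ⟨h1', h2', h1, h2⟩
    · exact absurd h2 h1'.ne

end PartialBrauer

theorem theorem6 (X : Type u) [Infinite X] :
    Cardinal.lift.{u + 1} (relativeRank (idempotentUnitGenerated (PartialBrauer X))
        (unitSet (PartialBrauer X))) = 2 + 2 * infiniteCardinalsLE X ∧
    (infiniteCardinalsLE X < ℵ₀ →
      ∀ Ω : Set (PartialBrauer X), Ω ⊆ idempotentUnitGenerated (PartialBrauer X) →
        Cardinal.lift.{u + 1} #Ω = 2 + 2 * infiniteCardinalsLE X →
        (Subsemigroup.closure (unitSet (PartialBrauer X) ∪ Ω) =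
            idempotentUnitGenerated (PartialBrauer X) ↔
          IsStandardFamily Ω)) := by
  rw [← PartialBrauer.mk_level_sum]
  refine ⟨PartialBrauer.lift_relativeRank X, fun hρ Ω hΩ hc => ⟨fun hgen => ?_, fun h => ?_⟩⟩
  · exact PartialBrauer.isStandardFamily_of_closure_eq hρ hΩ
      (hc.trans PartialBrauer.mk_level_sum) hgen
  · exact (PartialBrauer.IsStandardFamily.hasExtremal h).closure_eq hΩ
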